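/- Let $\phi:\mathbb R\to[0,\infty)$ be convex and differentiable with $|\phi'(z)|\le L$ and $|\phi'(z)-\phi'(z')|\le\gamma|z-z'|$ for all $z,z'$, where $\gamma>0$. Let $R>0$, $\Omega=\{w\in\mathbb R^d:|w|\le R\}$, and $C=LR+\phi(0)>0$. Let $(x_1,y_1),(x_2,y_2),\dots$ be i.i.d. with $x_i\in\mathbb R^d$, $|x_i|\le1$ and $y_i\in\{-1,+1\}$ almost surely. Let $\ell(w)=\mathbb E[\phi(y\,w^\top x)]$, and let $w_*$ be a minimizer of $\ell$ over $\Omega$. Let $\delta\in(0,1)$, let $m\ge1$ be the number of epochs, and put $t=\log(1/\delta)+\log m+1+R^2\gamma/C$. Epoch $k\in\{1,\dots,m\}$ uses the next $T_k=T_1 2^{k-1}$ examples $(x_k^i,y_k^i)$, $1\le i\le T_k$, where $T_1\ge 1$, and runs projected stochastic gradient descent $$w_k^1=0,\qquad w_k^{i+1}=\pi_\Omega\bigl(w_k^i-\eta_k\nabla\ell_k^i(w_k^i)\bigr),\qquad \ell_k^i(w)=\phi(y_k^i\,w^\top x_k^i).$$ Put $D_k=\frac1{T_k}\sum_{i=1}^{T_k}\ell(w_k^i)$,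 $\hat D_k=\frac1{T_k}\sum_{i=1}^{T_k}\ell_k^i(w_k^i)$ and $\hat w_k=\frac1{T_k}\sum_{i=1}^{T_k}w_k^i$. The step size $\eta_1>0$ is arbitrary, and $$\hat\ell_k=\hat D_k+6\Bigl(\sqrt{\tfrac{Ct}{T_k}\hat D_k}+\tfrac{Ct}{T_k}\Bigr),\qquad \eta_{k+1}=\frac{R}{2\sqrt{\gamma\,T_{k+1}\,\hat\ell_k}}.$$ There is a universal constant $K_0>0$ such that for every $K\ge K_0$ and all data as above the following holds, where $B_k$ denotes the event $$D_k-\ell(w_*)\le K\Bigl(\frac{Ct}{T_k}+\sqrt{\frac{Ct}{T_k}\,\ell(w_*)}\Bigr).$$ 1. (Upper surrogate.) For $1\le k\le m$, $\ell(w_*)\le\hat\ell_k$ with probability at least $1-\delta/m$. 2. (Induction step.) For $1\le k<m$, the probability that $B_k$ holds and $B_{k+1}$ fails is at most $\delta/m$. 3. (Optimistic rate.) Let $n=T_1+\dots+T_m$ be the total number of examples. If $B_1$ has probability at least $1-q$, then with probability at least $1-q-\delta$ all of $B_1,\dots,B_m$ hold and $$\ell(\hat w_m)-\ell(w_*)\le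 2K\Bigl(\frac{Ct}{n}+\sqrt{\frac{Ct}{n}\,\ell(w_*)}\Bigr).$$ If $T_1\le t$ (for instance $T_1=1$), the same holds with probability at least $1-\delta$, without any assumption on $B_1$. -/

import Mathlib

open MeasureTheory ProbabilityTheory
open scoped BigOperators RealInnerProductSpace

noncomputable section

/-- A labelled example `(x, y)`, with `x` in `ℝᵈ` (Euclidean norm) and a real label `y`. -/
abbrev Example (d : ℕ) : Type := EuclideanSpace ℝ (Fin d) × ℝ

/-- The loss `φ (y ⟨w, x⟩)` of the linear predictor `w` on the example `z = (x, y)`. -/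
def sampleLoss {d : ℕ} (φ : ℝ → ℝ) (z : Example d) (w : EuclideanSpace ℝ (Fin d)) : ℝ :=
  φ (z.2 * ⟪w, z.1⟫)

/-- The expected loss `ℓ(w) = 𝔼 φ (y ⟨w, x⟩)` when `(x, y)` has law `μ`. -/
def expectedLoss {d : ℕ} (φ : ℝ → ℝ) (μ : Measure (Example d))
    (w : EuclideanSpace ℝ (Fin d)) : ℝ :=
  ∫ z, sampleLoss φ z w ∂μ

/-- The metric projection of `ℝᵈ` onto the closed ball of radius `R` around `0`
(see `projBall_mem` and `projBall_dist_le`). -/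
def projBall {d : ℕ} (R : ℝ) (v : EuclideanSpace ℝ (Fin d)) : EuclideanSpace ℝ (Fin d) :=
  if ‖v‖ ≤ R then v else (R / ‖v‖) • v

theorem projBall_mem {d : ℕ} {R : ℝ} (hR : 0 ≤ R) (v : EuclideanSpace ℝ (Fin d)) :
    ‖projBall R v‖ ≤ R := by
  unfold projBall
  split_ifs with h
  · exact h
  · have hv : 0 < ‖v‖ := lt_of_le_of_lt hR (not_le.mp h)
    rw [norm_smul, Real.norm_of_nonneg (div_nonneg hR hv.le), div_mul_cancel₀ _ hv.ne']

theorem projBall_dist_le {d : ℕ} {R : ℝ} (hR : 0 ≤ R) (v u : EuclideanSpace ℝ (Fin d))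
    (hu : ‖u‖ ≤ R) : ‖v - projBall R v‖ ≤ ‖v - u‖ := by
  unfold projBall
  split_ifs with h
  · simp
  · have hlt := not_le.mp h
    have hv : 0 < ‖v‖ := lt_of_le_of_lt hR hlt
    have h1 : v - (R / ‖v‖) • v = (1 - R / ‖v‖) • v := by rw [sub_smul, one_smul]
    have h2 : 0 ≤ 1 - R / ‖v‖ := by
      rw [sub_nonneg, div_le_one hv]; exact hlt.le
    have h3 : (1 - R / ‖v‖) * ‖v‖ = ‖v‖ - R := by field_simp
    rw [h1, norm_smul, Real.norm_of_nonneg h2, h3]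
    linarith [norm_sub_norm_le v u]

/-- Projected stochastic gradient descent with constant step size `η` over the ball of radius `R`,
started at `0`; `sgd φ R η s i` is the `(i+1)`-st iterate, and it uses the examples
`s 0, …, s (i-1)`. -/
def sgd {d : ℕ} (φ : ℝ → ℝ) (R η : ℝ) (s : ℕ → Example d) : ℕ → EuclideanSpace ℝ (Fin d)
  | 0 => 0
  | i + 1 => projBall R (sgd φ R η s i - η • gradient (sampleLoss φ (s i)) (sgd φ R η s i))

/-- The data which the epoch-doubling algorithm is run with: the loss `φ`, the bound `L` on `φ'`,
the Lipschitz constant `γ` of `φ'`, the radius `R`, the confidence `δ`, the number `m` of epochs,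
the length `T₁` and the step size `η₁` of the first epoch. -/
structure DoublingData where
  φ : ℝ → ℝ
  L : ℝ
  γ : ℝ
  R : ℝ
  δ : ℝ
  m : ℕ
  T₁ : ℕ
  η₁ : ℝ

namespace DoublingData

variable (p : DoublingData) {d : ℕ}

/-- `C = L R + φ(0)`. -/
def C : ℝ := p.L * p.R + p.φ 0

/-- `t = log (1/δ) + log m + 1 + R² γ / C`. -/
def t : ℝ := Real.log (1 / p.δ) + Real.log p.m + 1 + p.R ^ 2 * p.γ / p.C

/-- The length `T_k = T₁ 2^(k-1)` of epoch `k`; epochs are numbered `1, 2, …, m`. -/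
def T (k : ℕ) : ℕ := p.T₁ * 2 ^ (k - 1)

/-- The number of examples that are used before epoch `k`. -/
def start (k : ℕ) : ℕ := ∑ j ∈ Finset.Ico 1 k, p.T j

/-- The total number `n = T_1 + ⋯ + T_m` of examples. -/
def n : ℕ := ∑ j ∈ Finset.Icc 1 p.m, p.T j

/-- The block of examples of epoch `k`, in a stream `s` of examples. -/
def block (s : ℕ → Example d) (k : ℕ) : ℕ → Example d := fun i => s (p.start k + i)

/-- The average observed loss of epoch `k`, when that epoch is run with step size `η`. -/
def empLossWith (s : ℕ → Example d) (η : ℝ) (k : ℕ) : ℝ :=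
  (1 / (p.T k : ℝ)) *
    ∑ i ∈ Finset.range (p.T k), sampleLoss p.φ (p.block s k i) (sgd p.φ p.R η (p.block s k) i)

/-- `D + 6 (√((C t / T_k) D) + C t / T_k)`, as a function of `D`. -/
def surrogateOf (k : ℕ) (D : ℝ) : ℝ :=
  D + 6 * (Real.sqrt (p.C * p.t / p.T k * D) + p.C * p.t / p.T k)

/-- The step sizes `η_1 = η₁` and `η_{k+1} = R / (2 √(γ T_{k+1} ℓ̂_k))`, where `ℓ̂_k` is computed
from the examples of epoch `k`. There is no epoch `0`, and the value there is not used. -/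
def stepSize (s : ℕ → Example d) : ℕ → ℝ
  | 0 => p.η₁
  | 1 => p.η₁
  | k + 2 => p.R / (2 * Real.sqrt (p.γ * p.T (k + 2) *
      p.surrogateOf (k + 1) (p.empLossWith s (stepSize s (k + 1)) (k + 1))))

/-- The iterates of epoch `k`; `iterate s k i` is the `(i+1)`-st one. -/
def iterate (s : ℕ → Example d) (k i : ℕ) : EuclideanSpace ℝ (Fin d) :=
  sgd p.φ p.R (p.stepSize s k) (p.block s k) i

/-- The average observed loss of epoch `k`. -/
def empLoss (s : ℕ → Example d) (k : ℕ) : ℝ := p.empLossWith s (p.stepSize s k) k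

/-- The surrogate `ℓ̂_k`; it depends on the observed examples and on the data `p` only. -/
def surrogate (s : ℕ → Example d) (k : ℕ) : ℝ := p.surrogateOf k (p.empLoss s k)

/-- `D_k`, the average of the expected losses of the iterates of epoch `k`. -/
def avgRisk (μ : Measure (Example d)) (s : ℕ → Example d) (k : ℕ) : ℝ :=
  (1 / (p.T k : ℝ)) * ∑ i ∈ Finset.range (p.T k), expectedLoss p.φ μ (p.iterate s k i)

/-- The average of the iterates of epoch `k`. -/
def avgIterate (s : ℕ → Example d) (k : ℕ) : EuclideanSpace ℝ (Fin d) :=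
  (1 / (p.T k : ℝ)) • ∑ i ∈ Finset.range (p.T k), p.iterate s k i

/-- The optimistic rate `C t / N + √((C t / N) r)` for `N` examples and optimal risk `r`. -/
def rate (N : ℕ) (r : ℝ) : ℝ := p.C * p.t / N + Real.sqrt (p.C * p.t / N * r)

end DoublingData

end

/-! Write `a = C t / T` for the fast rate of an epoch. A nonnegative smooth function satisfies `φ'²
≤ 4γφ`, so the squared gradients in the regret of gradient descent are paid for by the losses
themselves (`sgd_regret`). Since `R²γ ≤ C t`, a step size tuned to a guess `H` of the optimal risk
`ℓ` gives empirical regret at most `√(aH) + √(a/H) E`, where `E` is the observed loss.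

The guess is the surrogate of the previous epoch. It must satisfy `H ≥ ℓ`, so that `√(a/H) ℓ ≤
√(aℓ)`, and, on the event that the previous epoch has excess risk of order `K`, also `H = O(K (a +
ℓ))`. Then the regret is of order `√K (a + √(aℓ))`. The constant enters the next epoch only through
its square root, so for `K` large the same `K` is reproduced and does not grow with the epochs
(`excess_le_of_epoch`).

Observed and expected losses are compared by a multiplicative Chernoff bound for adapted strategies
(`measureReal_adapted_deviation_le`). Its parameter is fixed in advance at the scale of the
deterministic `ℓ`, not of the random `D_k`, so no peeling is needed, and the only union over epochs
costs `log m`. Chaining the epochs, Jensen's inequality and `n ≤ 2 T_m` give the final rate. -/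

/-! ### Self-bounding losses and the regret of projected gradient descent. -/

theorem inner_sub_projBall_nonneg {d : ℕ} {R : ℝ} (hR : 0 < R) (v u : EuclideanSpace ℝ (Fin d))
    (hu : ‖u‖ ≤ R) : 0 ≤ ⟪v - projBall R v, projBall R v - u⟫ := by
  unfold projBall
  split_ifs with h
  · simp
  · have hlt := not_le.mp h
    have hv : 0 < ‖v‖ := hR.trans hlt
    have h1 : v - (R / ‖v‖) • v = (1 - R / ‖v‖) • v := by rw [sub_smul, one_smul]
    have h2 : 0 ≤ 1 - R / ‖v‖ := by
      rw [sub_nonneg, div_le_one hv]; exact hlt.le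
    rw [h1, real_inner_smul_left, inner_sub_right, real_inner_smul_right,
      real_inner_self_eq_norm_sq]
    refine mul_nonneg h2 ?_
    have h3 : R / ‖v‖ * ‖v‖ ^ 2 = R * ‖v‖ := by field_simp
    have h4 : ⟪v, u⟫ ≤ ‖v‖ * ‖u‖ := real_inner_le_norm v u
    rw [h3]
    nlinarith

/-- The projection onto the ball does not increase the distance to a point of the ball. -/
theorem norm_projBall_sub_le {d : ℕ} {R : ℝ} (hR : 0 < R) (v u : EuclideanSpace ℝ (Fin d))
    (hu : ‖u‖ ≤ R) : ‖projBall R v - u‖ ≤ ‖v - u‖ := by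
  have h := inner_sub_projBall_nonneg hR v u hu
  have h1 : ‖v - u‖ ^ 2 = ‖v - projBall R v‖ ^ 2
      + 2 * ⟪v - projBall R v, projBall R v - u⟫ + ‖projBall R v - u‖ ^ 2 := by
    rw [← norm_add_sq_real, sub_add_sub_cancel]
  refine le_of_sq_le_sq ?_ (norm_nonneg _)
  nlinarith [sq_nonneg ‖v - projBall R v‖]

theorem norm_sgd_le {d : ℕ} (φ : ℝ → ℝ) {R : ℝ} (hR : 0 ≤ R) (η : ℝ) (s : ℕ → Example d) (i : ℕ) :
    ‖sgd φ R η s i‖ ≤ R := by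
  cases i with
  | zero => simpa [sgd] using hR
  | succ i => exact projBall_mem hR _

/-- A nonnegative function with `γ`-Lipschitz derivative is self-bounding. -/
theorem deriv_sq_le_of_nonneg {φ : ℝ → ℝ} {γ : ℝ} (h0 : ∀ z, 0 ≤ φ z) (hd : Differentiable ℝ φ)
    (hγ : 0 < γ) (hlip : ∀ z z', |deriv φ z - deriv φ z'| ≤ γ * |z - z'|) (z : ℝ) :
    deriv φ z ^ 2 ≤ 4 * γ * φ z := by
  -- The mean value theorem gives `γ` instead of the sharp `γ / 2`, whence the final constant `4γ`.
  have key : ∀ z', φ z' ≤ φ z + deriv φ z * (z' - z) + γ * (z' - z) ^ 2 := by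
    intro z'
    rcases eq_or_ne z' z with rfl | hne
    · simp
    obtain ⟨ξ, hξ, hmv⟩ : ∃ ξ, |ξ - z| ≤ |z' - z| ∧ φ z' - φ z = deriv φ ξ * (z' - z) := by
      rcases lt_or_gt_of_ne hne with hlt | hlt
      · obtain ⟨ξ, hξ, h⟩ := exists_deriv_eq_slope φ hlt hd.continuous.continuousOn
          hd.differentiableOn
        refine ⟨ξ, ?_, ?_⟩
        · rw [abs_of_neg (by linarith [hξ.2]), abs_of_neg (by linarith)]; linarith [hξ.1]
        · rw [h]; field_simp [(sub_pos.2 hlt).ne']; ring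
      · obtain ⟨ξ, hξ, h⟩ := exists_deriv_eq_slope φ hlt hd.continuous.continuousOn
          hd.differentiableOn
        refine ⟨ξ, ?_, ?_⟩
        · rw [abs_of_pos (by linarith [hξ.1]), abs_of_pos (by linarith)]; linarith [hξ.2]
        · rw [h, div_mul_cancel₀ _ (sub_pos.2 hlt).ne']
    have h1 : (deriv φ ξ - deriv φ z) * (z' - z) ≤ γ * (z' - z) ^ 2 := by
      calc (deriv φ ξ - deriv φ z) * (z' - z) ≤ |(deriv φ ξ - deriv φ z) * (z' - z)| := le_abs_self _
        _ = |deriv φ ξ - deriv φ z| * |z' - z| := abs_mul _ _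
        _ ≤ γ * |z' - z| * |z' - z| := by
            gcongr
            exact (hlip ξ z).trans (by gcongr)
        _ = γ * (z' - z) ^ 2 := by rw [mul_assoc, abs_mul_abs_self, sq]
    nlinarith
  -- The minimizer of the quadratic upper bound; nonnegativity there is the claim.
  have h := (h0 _).trans (key (z - deriv φ z / (2 * γ)))
  have h2 : φ z + deriv φ z * (z - deriv φ z / (2 * γ) - z)
      + γ * (z - deriv φ z / (2 * γ) - z) ^ 2 = φ z - deriv φ z ^ 2 / (4 * γ) := by
    field_simp; ring
  rw [h2, sub_nonneg, div_le_iff₀ (by positivity)] at h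
  linarith

theorem hasGradientAt_sampleLoss {d : ℕ} {φ : ℝ → ℝ} (hd : Differentiable ℝ φ) (z : Example d)
    (w : EuclideanSpace ℝ (Fin d)) :
    HasGradientAt (sampleLoss φ z) ((deriv φ (z.2 * ⟪w, z.1⟫) * z.2) • z.1) w := by
  rw [hasGradientAt_iff_hasFDerivAt]
  have h1 : HasFDerivAt (fun w : EuclideanSpace ℝ (Fin d) => z.2 * ⟪w, z.1⟫)
      (z.2 • innerSL ℝ z.1) w := by
    have := ((innerSL ℝ z.1).hasFDerivAt (x := w)).const_mul z.2
    refine this.congr_of_eventuallyEq (Filter.Eventually.of_forall fun w => ?_)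
    simp [real_inner_comm]
  have h2 := (hd (z.2 * ⟪w, z.1⟫)).hasDerivAt.comp_hasFDerivAt w h1
  refine h2.congr_fderiv ?_
  ext v
  simp [mul_assoc]

theorem gradient_sampleLoss {d : ℕ} {φ : ℝ → ℝ} (hd : Differentiable ℝ φ) (z : Example d)
    (w : EuclideanSpace ℝ (Fin d)) :
    gradient (sampleLoss φ z) w = (deriv φ (z.2 * ⟪w, z.1⟫) * z.2) • z.1 :=
  (hasGradientAt_sampleLoss hd z w).gradient

theorem abs_margin_le {d : ℕ} {R : ℝ} {z : Example d} (hz : ‖z.1‖ ≤ 1 ∧ (z.2 = 1 ∨ z.2 = -1))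
    {w : EuclideanSpace ℝ (Fin d)} (hw : ‖w‖ ≤ R) : |z.2 * ⟪w, z.1⟫| ≤ R := by
  have hy : |z.2| = 1 := by rcases hz.2 with h | h <;> simp [h]
  rw [abs_mul, hy, one_mul]
  calc |⟪w, z.1⟫| ≤ ‖w‖ * ‖z.1‖ := abs_real_inner_le_norm _ _
    _ ≤ R * 1 := mul_le_mul hw hz.1 (norm_nonneg _) ((norm_nonneg _).trans hw)
    _ = R := mul_one R

theorem sampleLoss_le {d : ℕ} {φ : ℝ → ℝ} {L R : ℝ} (hd : Differentiable ℝ φ)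
    (hL : ∀ z, |deriv φ z| ≤ L) {z : Example d} (hz : ‖z.1‖ ≤ 1 ∧ (z.2 = 1 ∨ z.2 = -1))
    {w : EuclideanSpace ℝ (Fin d)} (hw : ‖w‖ ≤ R) : sampleLoss φ z w ≤ L * R + φ 0 := by
  have h := Convex.norm_image_sub_le_of_norm_deriv_le (f := φ) (s := Set.univ) (C := L)
    (fun x _ => hd x) (fun x _ => hL x) convex_univ (Set.mem_univ 0)
    (Set.mem_univ (z.2 * ⟪w, z.1⟫))
  have hL0 : 0 ≤ L := (abs_nonneg _).trans (hL 0)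
  have h2 : L * ‖z.2 * ⟪w, z.1⟫ - 0‖ ≤ L * R := by
    rw [sub_zero]
    exact mul_le_mul_of_nonneg_left (abs_margin_le hz hw) hL0
  have h3 := (le_abs_self _).trans (h.trans h2)
  unfold sampleLoss
  linarith

theorem sampleLoss_sub_le_inner_gradient {d : ℕ} {φ : ℝ → ℝ} (hd : Differentiable ℝ φ)
    (hc : ConvexOn ℝ Set.univ φ) (z : Example d) (w u : EuclideanSpace ℝ (Fin d)) :
    sampleLoss φ z w - sampleLoss φ z u ≤ ⟪gradient (sampleLoss φ z) w, w - u⟫ := by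
  rw [gradient_sampleLoss hd, real_inner_smul_left, inner_sub_right, real_inner_comm w z.1,
    real_inner_comm u z.1]
  unfold sampleLoss
  set a := z.2 * ⟪w, z.1⟫ with ha
  set b := z.2 * ⟪u, z.1⟫ with hb
  have key : φ a - φ b ≤ deriv φ a * (a - b) := by
    rcases lt_trichotomy a b with h | h | h
    · have := hc.deriv_le_slope (Set.mem_univ a) (Set.mem_univ b) h (hd a)
      rw [slope_def_field, le_div_iff₀ (by linarith)] at this
      linarith
    · simp [h]
    · have := hc.slope_le_deriv (Set.mem_univ b) (Set.mem_univ a) h (hd a)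
      rw [slope_def_field, div_le_iff₀ (by linarith)] at this
      linarith
  calc φ a - φ b ≤ deriv φ a * (a - b) := key
    _ = deriv φ a * z.2 * (⟪w, z.1⟫ - ⟪u, z.1⟫) := by rw [ha, hb]; ring

theorem norm_gradient_sampleLoss_sq_le {d : ℕ} {φ : ℝ → ℝ} {γ : ℝ} (h0 : ∀ z, 0 ≤ φ z)
    (hd : Differentiable ℝ φ) (hγ : 0 < γ)
    (hlip : ∀ z z', |deriv φ z - deriv φ z'| ≤ γ * |z - z'|)
    {z : Example d} (hz : ‖z.1‖ ≤ 1 ∧ (z.2 = 1 ∨ z.2 = -1)) (w : EuclideanSpace ℝ (Fin d)) :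
    ‖gradient (sampleLoss φ z) w‖ ^ 2 ≤ 4 * γ * sampleLoss φ z w := by
  rw [gradient_sampleLoss hd, norm_smul, mul_pow, Real.norm_eq_abs, sq_abs, mul_pow]
  have hy : z.2 ^ 2 = 1 := by rcases hz.2 with h | h <;> simp [h]
  rw [hy, mul_one]
  calc deriv φ (z.2 * ⟪w, z.1⟫) ^ 2 * ‖z.1‖ ^ 2
      ≤ deriv φ (z.2 * ⟪w, z.1⟫) ^ 2 * 1 := by
        gcongr; exact pow_le_one₀ (norm_nonneg _) hz.1
    _ ≤ 4 * γ * φ (z.2 * ⟪w, z.1⟫) := by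
        rw [mul_one]; exact deriv_sq_le_of_nonneg h0 hd hγ hlip _

/-- The regret bound of projected stochastic gradient descent for self-bounding losses. -/
theorem sgd_regret {d : ℕ} {φ : ℝ → ℝ} {γ R : ℝ} (h0 : ∀ z, 0 ≤ φ z) (hc : ConvexOn ℝ Set.univ φ)
    (hd : Differentiable ℝ φ) (hγ : 0 < γ)
    (hlip : ∀ z z', |deriv φ z - deriv φ z'| ≤ γ * |z - z'|) (hR : 0 < R) {η : ℝ} (hη : 0 < η)
    {s : ℕ → Example d} (hs : ∀ i, ‖(s i).1‖ ≤ 1 ∧ ((s i).2 = 1 ∨ (s i).2 = -1))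
    {u : EuclideanSpace ℝ (Fin d)} (hu : ‖u‖ ≤ R) (T : ℕ) :
    ∑ i ∈ Finset.range T, (sampleLoss φ (s i) (sgd φ R η s i) - sampleLoss φ (s i) u)
      ≤ R ^ 2 / (2 * η)
        + 2 * η * γ * ∑ i ∈ Finset.range T, sampleLoss φ (s i) (sgd φ R η s i) := by
  -- The potential `‖w - u‖²` telescopes and starts at `‖u‖²`; `h3` replaces the squared gradient by
  -- the loss.
  have key : ∀ n, 2 * η * ∑ i ∈ Finset.range n,
      (sampleLoss φ (s i) (sgd φ R η s i) - sampleLoss φ (s i) u)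
      ≤ ‖u‖ ^ 2 - ‖sgd φ R η s n - u‖ ^ 2
        + 4 * η ^ 2 * γ * ∑ i ∈ Finset.range n, sampleLoss φ (s i) (sgd φ R η s i) := by
    intro n
    induction n with
    | zero => simp [sgd]
    | succ n ih =>
      rw [Finset.sum_range_succ, Finset.sum_range_succ]
      set w := sgd φ R η s n with hw
      set g := gradient (sampleLoss φ (s n)) w with hg
      have h1 : ‖sgd φ R η s (n + 1) - u‖ ^ 2 ≤ ‖w - u‖ ^ 2 - 2 * η * ⟪g, w - u⟫
          + η ^ 2 * ‖g‖ ^ 2 := by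
        have : ‖sgd φ R η s (n + 1) - u‖ ≤ ‖(w - u) - η • g‖ := by
          have h := norm_projBall_sub_le hR (w - η • g) u hu
          rwa [sub_right_comm] at h
        calc ‖sgd φ R η s (n + 1) - u‖ ^ 2 ≤ ‖(w - u) - η • g‖ ^ 2 := by gcongr
          _ = _ := by
            rw [norm_sub_sq_real, norm_smul, real_inner_smul_right, real_inner_comm, mul_pow,
              Real.norm_eq_abs, sq_abs]
            ring
      have h2 := sampleLoss_sub_le_inner_gradient hd hc (s n) w u
      have h3 := norm_gradient_sampleLoss_sq_le h0 hd hγ hlip (hs n) w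
      have h4 : 2 * η * (sampleLoss φ (s n) w - sampleLoss φ (s n) u) ≤ 2 * η * ⟪g, w - u⟫ := by
        gcongr
      have h5 : η ^ 2 * ‖g‖ ^ 2 ≤ η ^ 2 * (4 * γ * sampleLoss φ (s n) w) := by gcongr
      linarith
  have h := key T
  have h6 : ‖u‖ ^ 2 ≤ R ^ 2 := by gcongr
  have h7 := sq_nonneg ‖sgd φ R η s T - u‖
  set A := ∑ i ∈ Finset.range T, (sampleLoss φ (s i) (sgd φ R η s i) - sampleLoss φ (s i) u)
  set B := ∑ i ∈ Finset.range T, sampleLoss φ (s i) (sgd φ R η s i)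
  have h8 : R ^ 2 / (2 * η) + 2 * η * γ * B = (R ^ 2 + 4 * η ^ 2 * γ * B) / (2 * η) := by
    field_simp; ring
  rw [h8, le_div_iff₀ (by positivity)]
  linarith

/-! ### Concentration for adapted strategies. -/

/-- The exponential supermartingale bound for i.i.d. samples: a product of nonnegative factors, each
of which depends on the past and on one new sample and has mean at most one given the past, has
mean at most one. -/
theorem lintegral_prod_adapted_le_one {Ω X : Type*} [MeasurableSpace Ω] [MeasurableSpace X]
    {P : Measure Ω} [IsProbabilityMeasure P] {μ : Measure X} [IsProbabilityMeasure μ]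
    {Z : ℕ → Ω → X} (hZ : ∀ i, Measurable (Z i)) (hlaw : ∀ i, P.map (Z i) = μ)
    (hind : iIndepFun Z P) (G : ℕ → (ℕ → X) → X → ENNReal)
    (hG : ∀ i, Measurable (Function.uncurry (G i))) (a : ℕ)
    (hadapt : ∀ i s s', (∀ j < a + i, s j = s' j) → G i s = G i s')
    (hint : ∀ i s, ∫⁻ z, G i s z ∂μ ≤ 1) (T : ℕ) :
    ∫⁻ ω, ∏ i ∈ Finset.range T, G i (fun j => Z j ω) (Z (a + i) ω) ∂P ≤ 1 := by
  induction T with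
  | zero => simp
  | succ T ih =>
    obtain ⟨x₀⟩ : Nonempty X := nonempty_of_isProbabilityMeasure μ
    set N := a + T with hN
    -- The past, padded by a constant to a full stream: it is independent of `Z N`, and adapted
    -- factors cannot tell it from the true stream. Fubini then integrates out the newest sample.
    let Y : Ω → ℕ → X := fun ω j => if j < N then Z j ω else x₀
    have hYm : Measurable Y := by
      refine measurable_pi_lambda _ fun j => ?_
      by_cases hj : j < N
      · simpa [Y, hj] using hZ j
      · simp [Y, hj]
    have hY : ∀ ω, ∀ j < N, Z j ω = Y ω j := fun ω j hj => by simp [Y, hj]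
    have hYZ : IndepFun Y (Z N) P := by
      have h := hind.indepFun_finset (Finset.range N) {N} (by simp) hZ
      have hproj : Measurable fun f : ({N} : Finset ℕ) → X => f ⟨N, Finset.mem_singleton_self N⟩ :=
        measurable_pi_apply _
      have h1 := h.comp
        (φ := fun (f : Finset.range N → X) (j : ℕ) =>
          if hj : j < N then f ⟨j, Finset.mem_range.2 hj⟩ else x₀)
        (ψ := fun f => f ⟨N, Finset.mem_singleton_self N⟩)
        (by
          refine measurable_pi_lambda _ fun j => ?_
          by_cases hj : j < N
          · simpa [hj] using measurable_pi_apply _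
          · simp [hj])
        hproj
      convert h1 using 1
      · funext ω j
        simp [Y]
      · rfl
    let M : (ℕ → X) → ENNReal := fun s => ∏ i ∈ Finset.range T, G i s (s (a + i))
    have hM : Measurable M :=
      Finset.measurable_prod _ fun i _ => (hG i).comp (measurable_id.prodMk (measurable_pi_apply _))
    have hMY : ∀ ω, M (fun j => Z j ω) = M (Y ω) := by
      intro ω
      refine Finset.prod_congr rfl fun i hi => ?_
      have hi' := Finset.mem_range.1 hi
      rw [hadapt i _ (Y ω) fun j hj => hY ω j (by omega)]
      exact congrArg _ (hY ω _ (by omega))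
    have hmap : P.map (fun ω => (Y ω, Z N ω)) = (P.map Y).prod μ := by
      rw [(indepFun_iff_map_prod_eq_prod_map_map hYm.aemeasurable (hZ N).aemeasurable).1 hYZ,
        hlaw]
    have : IsProbabilityMeasure (P.map Y) := Measure.isProbabilityMeasure_map hYm.aemeasurable
    have hH : Measurable fun q : (ℕ → X) × X => M q.1 * G T q.1 q.2 :=
      (hM.comp measurable_fst).mul (hG T)
    calc ∫⁻ ω, ∏ i ∈ Finset.range (T + 1), G i (fun j => Z j ω) (Z (a + i) ω) ∂P
        = ∫⁻ ω, M (Y ω) * G T (Y ω) (Z N ω) ∂P := by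
          refine lintegral_congr fun ω => ?_
          rw [Finset.prod_range_succ, ← hMY, hadapt T _ (Y ω) (hY ω)]
      _ = ∫⁻ q, M q.1 * G T q.1 q.2 ∂((P.map Y).prod μ) := by
          rw [← hmap, lintegral_map hH (hYm.prodMk (hZ N))]
      _ = ∫⁻ y, ∫⁻ z, M y * G T y z ∂μ ∂(P.map Y) := lintegral_prod _ hH.aemeasurable
      _ ≤ ∫⁻ y, M y ∂(P.map Y) := by
          refine lintegral_mono fun y => ?_
          rw [lintegral_const_mul _ ((hG T).of_uncurry_left (x := y))]
          exact mul_le_of_le_one_right' (hint T y)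
      _ = ∫⁻ ω, ∏ i ∈ Finset.range T, G i (fun j => Z j ω) (Z (a + i) ω) ∂P := by
          rw [lintegral_map hM hYm]
          exact lintegral_congr fun ω => (hMY ω).symm
      _ ≤ 1 := ih

/-- The exponential moment of a variable with values in `[0, C]`. -/
theorem lintegral_exp_sub_le_one {X : Type*} [MeasurableSpace X] {μ : Measure X}
    [IsProbabilityMeasure μ] {g : X → ℝ} (hg : Measurable g) {C : ℝ} (hC : 0 < C)
    (hb : ∀ᵐ z ∂μ, 0 ≤ g z ∧ g z ≤ C) (c : ℝ) :
    ∫⁻ z, ENNReal.ofReal (Real.exp (c / C * g z - (Real.exp c - 1) / C * ∫ x, g x ∂μ)) ∂μ ≤ 1 := by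
  set F := ∫ x, g x ∂μ with hF
  set ψ := (Real.exp c - 1) / C with hψ
  have hgi : Integrable g μ := by
    refine Integrable.of_bound hg.aestronglyMeasurable C ?_
    filter_upwards [hb] with z hz
    rw [Real.norm_of_nonneg hz.1]; exact hz.2
  have hpt : ∀ᵐ z ∂μ, Real.exp (c / C * g z - ψ * F) ≤ Real.exp (-(ψ * F)) * (1 + ψ * g z) := by
    filter_upwards [hb] with z hz
    rw [sub_eq_neg_add, Real.exp_add]
    refine mul_le_mul_of_nonneg_left ?_ (Real.exp_pos _).le
    -- On the segment between `0` and `c` the exponential lies below its chord, which makes the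
    -- moment linear in `g`.
    have h := convexOn_exp.2 (Set.mem_univ 0) (Set.mem_univ c)
      (sub_nonneg.2 ((div_le_one hC).2 hz.2)) (div_nonneg hz.1 hC.le) (sub_add_cancel _ _)
    simp only [smul_eq_mul, mul_zero, zero_add, Real.exp_zero, mul_one] at h
    calc Real.exp (c / C * g z) = Real.exp (g z / C * c) := by ring_nf
      _ ≤ _ := h
      _ = 1 + ψ * g z := by rw [hψ]; field_simp; ring
  have hi1 : Integrable (fun z => Real.exp (-(ψ * F)) * (1 + ψ * g z)) μ :=
    ((integrable_const 1).add (hgi.const_mul ψ)).const_mul _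
  calc ∫⁻ z, ENNReal.ofReal (Real.exp (c / C * g z - ψ * F)) ∂μ
      ≤ ∫⁻ z, ENNReal.ofReal (Real.exp (-(ψ * F)) * (1 + ψ * g z)) ∂μ :=
        lintegral_mono_ae (hpt.mono fun z hz => ENNReal.ofReal_le_ofReal hz)
    _ = ENNReal.ofReal (∫ z, Real.exp (-(ψ * F)) * (1 + ψ * g z) ∂μ) :=
        (ofReal_integral_eq_lintegral_ofReal hi1
          (hpt.mono fun z hz => (Real.exp_pos _).le.trans hz)).symm
    _ ≤ 1 := by
        rw [integral_const_mul, integral_add (integrable_const 1) (hgi.const_mul ψ),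
          integral_const_mul, integral_const, ← hF]
        simp only [probReal_univ, smul_eq_mul, mul_one]
        rw [ENNReal.ofReal_le_one]
        calc Real.exp (-(ψ * F)) * (1 + ψ * F) ≤ Real.exp (-(ψ * F)) * Real.exp (ψ * F) := by
              gcongr; linarith [Real.add_one_le_exp (ψ * F)]
          _ = 1 := by rw [← Real.exp_add]; simp

/-- Multiplicative concentration of the observed losses of an adapted strategy around their
conditional means, with `c > 0` for the upper and `c < 0` for the lower deviations. -/
theorem measureReal_adapted_deviation_le {Ω X E : Type*} [MeasurableSpace Ω] [MeasurableSpace X]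
    [MeasurableSpace E] {P : Measure Ω} [IsProbabilityMeasure P] {μ : Measure X}
    [IsProbabilityMeasure μ] {Z : ℕ → Ω → X} (hZ : ∀ i, Measurable (Z i))
    (hlaw : ∀ i, P.map (Z i) = μ) (hind : iIndepFun Z P)
    {f : X → E → ℝ} (hf : Measurable (Function.uncurry f)) {W : ℕ → (ℕ → X) → E}
    (hW : ∀ i, Measurable (W i)) (a : ℕ)
    (hadapt : ∀ i s s', (∀ j < a + i, s j = s' j) → W i s = W i s') {C : ℝ} (hC : 0 < C)
    (hb : ∀ i s, ∀ᵐ z ∂μ, 0 ≤ f z (W i s) ∧ f z (W i s) ≤ C) (c r : ℝ) (T : ℕ) :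
    P.real {ω | (Real.exp c - 1) * ∑ i ∈ Finset.range T, ∫ z, f z (W i fun j => Z j ω) ∂μ + C * r
      < c * ∑ i ∈ Finset.range T, f (Z (a + i) ω) (W i fun j => Z j ω)} ≤ Real.exp (-r) := by
  set F : E → ℝ := fun w => ∫ z, f z w ∂μ with hF
  have hFm : Measurable F :=
    (StronglyMeasurable.integral_prod_left hf.stronglyMeasurable).measurable
  let G : ℕ → (ℕ → X) → X → ENNReal := fun i s z =>
    ENNReal.ofReal (Real.exp (c / C * f z (W i s) - (Real.exp c - 1) / C * F (W i s)))
  have hG : ∀ i, Measurable (Function.uncurry (G i)) := by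
    intro i
    have h1 : Measurable fun q : (ℕ → X) × X => f q.2 (W i q.1) :=
      hf.comp (measurable_snd.prodMk ((hW i).comp measurable_fst))
    have h2 : Measurable fun q : (ℕ → X) × X => F (W i q.1) :=
      hFm.comp ((hW i).comp measurable_fst)
    exact ENNReal.measurable_ofReal.comp
      (Real.measurable_exp.comp ((h1.const_mul _).sub (h2.const_mul _)))
  have hmain := lintegral_prod_adapted_le_one hZ hlaw hind G hG a
    (fun i s s' h => by simp only [G, hadapt i s s' h])
    (fun i s => lintegral_exp_sub_le_one (hf.comp (measurable_id.prodMk measurable_const)) hC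
      (hb i s) c) T
  set M : Ω → ENNReal := fun ω => ∏ i ∈ Finset.range T, G i (fun j => Z j ω) (Z (a + i) ω)
  have hMm : Measurable M :=
    Finset.measurable_prod _ fun i _ =>
      (hG i).comp ((measurable_pi_lambda _ fun j => hZ j).prodMk (hZ _))
  have hsub : {ω | (Real.exp c - 1) * ∑ i ∈ Finset.range T, F (W i fun j => Z j ω) + C * r
      < c * ∑ i ∈ Finset.range T, f (Z (a + i) ω) (W i fun j => Z j ω)}
      ⊆ {ω | ENNReal.ofReal (Real.exp r) ≤ M ω} := by
    intro ω hω
    simp only [Set.mem_ofPred_eq] at hω ⊢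
    simp only [M, G]
    rw [← ENNReal.ofReal_prod_of_nonneg (fun i _ => (Real.exp_pos _).le), ← Real.exp_sum]
    refine ENNReal.ofReal_le_ofReal (Real.exp_le_exp.2 ?_)
    rw [Finset.sum_sub_distrib, ← Finset.mul_sum, ← Finset.mul_sum, div_mul_eq_mul_div,
      div_mul_eq_mul_div, ← sub_div, le_div_iff₀ hC]
    linarith
  have hmk := (mul_meas_ge_le_lintegral (μ := P) hMm (ENNReal.ofReal (Real.exp r))).trans hmain
  have h1 : Real.exp r * P.real {ω | ENNReal.ofReal (Real.exp r) ≤ M ω} ≤ 1 := by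
    have := ENNReal.toReal_mono ENNReal.one_ne_top hmk
    rwa [ENNReal.toReal_mul, ENNReal.toReal_ofReal (Real.exp_pos r).le, ENNReal.toReal_one] at this
  calc _ ≤ P.real {ω | ENNReal.ofReal (Real.exp r) ≤ M ω} := measureReal_mono hsub
    _ ≤ Real.exp (-r) := by
      rw [Real.exp_neg, ← one_div, le_div_iff₀' (Real.exp_pos r)]
      exact h1

/-! ### Measurability and adaptedness of the algorithm. -/

theorem measurable_projBall {d : ℕ} (R : ℝ) :
    Measurable (projBall R : EuclideanSpace ℝ (Fin d) → EuclideanSpace ℝ (Fin d)) := by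
  unfold projBall
  exact Measurable.ite (measurableSet_le measurable_norm measurable_const) measurable_id
    ((measurable_norm.const_div R).smul measurable_id)

theorem measurable_sampleLoss {d : ℕ} {φ : ℝ → ℝ} (hφ : Measurable φ) :
    Measurable (Function.uncurry (sampleLoss φ : Example d → EuclideanSpace ℝ (Fin d) → ℝ)) := by
  unfold Function.uncurry sampleLoss
  exact hφ.comp ((measurable_snd.comp measurable_fst).mul
    (measurable_snd.inner (measurable_fst.comp measurable_fst)))

theorem measurable_sgd {S : Type*} [MeasurableSpace S] {d : ℕ} {φ : ℝ → ℝ}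
    (hd : Differentiable ℝ φ) (R : ℝ) {η : S → ℝ} (hη : Measurable η) {s : S → ℕ → Example d}
    (hs : ∀ i, Measurable fun x => s x i) (i : ℕ) :
    Measurable fun x => sgd φ R (η x) (s x) i := by
  induction i with
  | zero => exact measurable_const
  | succ i ih =>
    simp only [sgd, gradient_sampleLoss hd]
    have hy : Measurable fun x => (s x i).2 := measurable_snd.comp (hs i)
    have hx : Measurable fun x => (s x i).1 := measurable_fst.comp (hs i)
    exact (measurable_projBall R).comp (ih.sub (hη.smul
      ((((measurable_deriv φ).comp (hy.mul (ih.inner hx))).mul hy).smul hx)))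

theorem sgd_congr {d : ℕ} (φ : ℝ → ℝ) (R η : ℝ) {s s' : ℕ → Example d} {i : ℕ}
    (h : ∀ j < i, s j = s' j) : sgd φ R η s i = sgd φ R η s' i := by
  induction i with
  | zero => rfl
  | succ i ih => simp only [sgd]; rw [ih fun j hj => h j (by omega), h i (by omega)]

theorem convexOn_sampleLoss {d : ℕ} {φ : ℝ → ℝ} (hc : ConvexOn ℝ Set.univ φ) (z : Example d) :
    ConvexOn ℝ Set.univ (sampleLoss φ z) := by
  refine ⟨convex_univ, fun u _ v _ a b ha hb hab => ?_⟩
  have h := hc.2 (Set.mem_univ (z.2 * ⟪u, z.1⟫)) (Set.mem_univ (z.2 * ⟪v, z.1⟫)) ha hb hab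
  unfold sampleLoss
  convert h using 2
  rw [inner_add_left, real_inner_smul_left, real_inner_smul_left]
  simp only [smul_eq_mul]
  ring

namespace DoublingData

variable (p : DoublingData) {d : ℕ}

theorem start_succ {k : ℕ} (hk : 1 ≤ k) : p.start (k + 1) = p.start k + p.T k :=
  Finset.sum_Ico_succ_top hk _

theorem measurable_block (k i : ℕ) : Measurable fun s : ℕ → Example d => p.block s k i :=
  measurable_pi_apply _

theorem measurable_empLossWith (hd : Differentiable ℝ p.φ) {η : (ℕ → Example d) → ℝ}
    (hη : Measurable η) (k : ℕ) : Measurable fun s => p.empLossWith s (η s) k := by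
  unfold empLossWith
  refine (Finset.measurable_sum _ fun i _ => ?_).const_mul _
  exact (measurable_sampleLoss hd.continuous.measurable).comp
    ((p.measurable_block k i).prodMk (measurable_sgd hd p.R hη (p.measurable_block k) i))

theorem measurable_stepSize (hd : Differentiable ℝ p.φ) (k : ℕ) :
    Measurable fun s : ℕ → Example d => p.stepSize s k := by
  induction k with
  | zero => simp only [stepSize]; exact measurable_const
  | succ k ih =>
    rcases k with _ | k
    · simp only [stepSize]; exact measurable_const
    · simp only [stepSize, surrogateOf]
      have h := p.measurable_empLossWith hd ih (k + 1)
      exact (((((h.add (((h.const_mul _).sqrt.add_const _).const_mul _)).const_mul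
        _).sqrt).const_mul _).const_div _)

theorem measurable_iterate (hd : Differentiable ℝ p.φ) (k i : ℕ) :
    Measurable fun s : ℕ → Example d => p.iterate s k i :=
  measurable_sgd hd p.R (p.measurable_stepSize hd k) (p.measurable_block k) i

/-- The step size is random but computed from earlier epochs alone; this keeps the iterates adapted,
as the concentration bound requires. -/
theorem stepSize_congr {s s' : ℕ → Example d} {k : ℕ} (hk : 1 ≤ k)
    (h : ∀ j < p.start k, s j = s' j) : p.stepSize s k = p.stepSize s' k := by
  induction k, hk using Nat.le_induction with
  | base => simp only [stepSize]
  | succ k hk ih =>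
    rw [p.start_succ hk] at h
    obtain ⟨k, rfl⟩ : ∃ l, k = l + 1 := ⟨k - 1, by omega⟩
    simp only [stepSize]
    have hb : ∀ i < p.T (k + 1), p.block s (k + 1) i = p.block s' (k + 1) i :=
      fun i hi => h _ (by omega)
    have he : p.empLossWith s (p.stepSize s (k + 1)) (k + 1)
        = p.empLossWith s' (p.stepSize s' (k + 1)) (k + 1) := by
      unfold empLossWith
      congr 1
      refine Finset.sum_congr rfl fun i hi => ?_
      have hi' := Finset.mem_range.1 hi
      rw [hb i hi', ih fun j hj => h j (by omega), sgd_congr _ _ _ fun j hj => hb j (by omega)]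
    rw [he]

theorem iterate_congr {s s' : ℕ → Example d} {k i : ℕ} (hk : 1 ≤ k)
    (h : ∀ j < p.start k + i, s j = s' j) : p.iterate s k i = p.iterate s' k i := by
  unfold iterate
  rw [p.stepSize_congr hk fun j hj => h j (by omega)]
  exact sgd_congr _ _ _ fun j hj => h _ (by omega)

theorem norm_iterate_le (hR : 0 ≤ p.R) (s : ℕ → Example d) (k i : ℕ) :
    ‖p.iterate s k i‖ ≤ p.R := norm_sgd_le _ hR _ _ _

/-! ### Epoch lengths and the confidence parameter. -/

theorem T_pos (hT : 1 ≤ p.T₁) (k : ℕ) : (0 : ℝ) < p.T k := by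
  have : 0 < p.T k := Nat.mul_pos hT (by positivity)
  exact_mod_cast this

theorem T_succ {k : ℕ} (hk : 1 ≤ k) : (p.T (k + 1) : ℝ) = 2 * p.T k := by
  obtain ⟨k, rfl⟩ : ∃ l, k = l + 1 := ⟨k - 1, by omega⟩
  simp only [T, Nat.add_sub_cancel]
  push_cast
  ring

theorem n_le (hm : 1 ≤ p.m) : (p.n : ℝ) ≤ 2 * p.T p.m := by
  have key : ∀ m, 1 ≤ m → ∑ j ∈ Finset.Icc 1 m, p.T j ≤ 2 * p.T m := by
    intro m hm
    induction m, hm using Nat.le_induction with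
    | base => simp only [Finset.Icc_self, Finset.sum_singleton]; omega
    | succ k hk ih =>
      rw [Finset.sum_Icc_succ_top (by omega)]
      have : p.T (k + 1) = 2 * p.T k := by exact_mod_cast p.T_succ hk
      omega
  exact_mod_cast key p.m hm

theorem T_le_n (hm : 1 ≤ p.m) : (p.T p.m : ℝ) ≤ p.n := by
  have : p.T p.m ≤ p.n :=
    Finset.single_le_sum (f := p.T) (fun _ _ => Nat.zero_le _) (Finset.mem_Icc.2 ⟨hm, le_rfl⟩)
  exact_mod_cast this

theorem t_ge (hγ : 0 < p.γ) (hC : 0 < p.C) :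
    Real.log (1 / p.δ) + Real.log p.m + 1 ≤ p.t := by
  unfold t
  have : 0 ≤ p.R ^ 2 * p.γ / p.C := by positivity
  linarith

theorem one_le_t (hγ : 0 < p.γ) (hC : 0 < p.C) (hδ : 0 < p.δ) (hδ1 : p.δ < 1) (hm : 1 ≤ p.m) :
    1 ≤ p.t := by
  have h1 : 0 ≤ Real.log (1 / p.δ) := Real.log_nonneg (by rw [le_div_iff₀ hδ]; linarith)
  have h2 : 0 ≤ Real.log p.m := Real.log_nonneg (by exact_mod_cast hm)
  linarith [p.t_ge hγ hC]

/-- The purpose of the summand `R²γ / C` of `t`: the optimization error is absorbed into the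
statistical rate. -/
theorem smoothness_le (hC : 0 < p.C) (hδ : 0 < p.δ) (hδ1 : p.δ < 1)
    (hm : 1 ≤ p.m) : p.R ^ 2 * p.γ ≤ p.C * p.t := by
  have h1 : 0 ≤ Real.log (1 / p.δ) := Real.log_nonneg (by rw [le_div_iff₀ hδ]; linarith)
  have h2 : 0 ≤ Real.log p.m := Real.log_nonneg (by exact_mod_cast hm)
  have h3 : p.R ^ 2 * p.γ / p.C ≤ p.t := by unfold t; linarith
  rwa [div_le_iff₀' hC] at h3

/-- The summand `1` of `t` leaves a spare factor `exp (-1)`, which pays for several deviation events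
per epoch. -/
theorem exp_neg_t_le (hγ : 0 < p.γ) (hC : 0 < p.C) (hδ : 0 < p.δ) (hm : 1 ≤ p.m) :
    Real.exp (-p.t) ≤ p.δ / p.m * Real.exp (-1) := by
  have hm' : (0 : ℝ) < p.m := by exact_mod_cast hm
  have h : -p.t ≤ Real.log (p.δ / p.m) + -1 := by
    have := p.t_ge hγ hC
    rw [one_div, Real.log_inv] at this
    rw [Real.log_div hδ.ne' hm'.ne']
    linarith
  calc Real.exp (-p.t) ≤ Real.exp (Real.log (p.δ / p.m) + -1) := Real.exp_le_exp.2 h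
    _ = _ := by rw [Real.exp_add, Real.exp_log (by positivity)]

end DoublingData

/-! ### Deterministic inequalities for one epoch. -/

/-- The deviation parameter `u = √(a / (ℓ + b²a))` balances the two error terms `u ℓ` and `a / u`;
the summand `b²a` caps it at `1 / b`. This and the next two lemmas record these properties. -/
theorem sqrt_div_add_mul_le {a ℓ b : ℝ} (ha : 0 < a) (hℓ : 0 ≤ ℓ) (hb : 0 < b) :
    √(a / (ℓ + b ^ 2 * a)) * ℓ ≤ √(a * ℓ) := by
  refine Real.le_sqrt_of_sq_le ?_
  have hpos : 0 < ℓ + b ^ 2 * a := by positivity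
  rw [mul_pow, Real.sq_sqrt (by positivity), div_mul_eq_mul_div, div_le_iff₀ hpos]
  have : 0 ≤ a * ℓ * (b ^ 2 * a) := by positivity
  nlinarith

theorem div_sqrt_div_add_le {a ℓ b : ℝ} (ha : 0 < a) (hℓ : 0 ≤ ℓ) (hb : 0 < b) :
    a / √(a / (ℓ + b ^ 2 * a)) ≤ √(a * ℓ) + b * a := by
  have hpos : 0 < ℓ + b ^ 2 * a := by positivity
  have h1 : a / √(a / (ℓ + b ^ 2 * a)) = √(a * (ℓ + b ^ 2 * a)) := by
    rw [Real.sqrt_div ha.le, Real.sqrt_mul ha.le, div_div_eq_mul_div, mul_comm, mul_div_assoc,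
      Real.div_sqrt, mul_comm]
  rw [h1]
  refine (Real.sqrt_le_left (by positivity)).2 ?_
  have h2 := Real.sq_sqrt (mul_nonneg ha.le hℓ)
  have h3 : 0 ≤ 2 * √(a * ℓ) * (b * a) := by positivity
  nlinarith

theorem sqrt_div_add_le {a ℓ b : ℝ} (ha : 0 < a) (hℓ : 0 ≤ ℓ) (hb : 0 < b) :
    √(a / (ℓ + b ^ 2 * a)) ≤ 1 / b := by
  refine (Real.sqrt_le_left (by positivity)).2 ?_
  rw [div_pow, one_pow, div_le_div_iff₀ (by positivity) (by positivity)]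
  nlinarith

/-- Inversion of a lower deviation bound at the scale of `ℓ` into an upper confidence bound. -/
theorem le_add_sqrt_of_lower_deviation {a ℓ D E : ℝ} (ha : 0 < a) (hℓ : 0 ≤ ℓ) (hℓD : ℓ ≤ D)
    (hE : 0 ≤ E) (h : D ≤ E + √(a / (ℓ + 1 ^ 2 * a)) * D + a / √(a / (ℓ + 1 ^ 2 * a))) :
    ℓ ≤ E + 6 * (√(a * E) + a) := by
  have h1 := sqrt_div_add_mul_le ha hℓ one_pos
  have h2 := div_sqrt_div_add_le ha hℓ one_pos
  have h3 := sqrt_div_add_le ha hℓ one_pos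
  set u := √(a / (ℓ + 1 ^ 2 * a))
  have h4 : (1 - u) * ℓ ≤ (1 - u) * D := by
    refine mul_le_mul_of_nonneg_left hℓD ?_
    linarith
  have hy0 := Real.sqrt_nonneg (a * ℓ)
  have hy := Real.sq_sqrt (mul_nonneg ha.le hℓ)
  have hq0 := Real.sqrt_nonneg (a * E)
  have hq := Real.sq_sqrt (mul_nonneg ha.le hE)
  set y := √(a * ℓ)
  set q := √(a * E)
  have h5 : ℓ ≤ E + 2 * y + a := by linarith
  -- Multiplying `h5` by `a` gives `y² ≤ q² + 2ay + a²`; complete the square.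
  have h6 : (y - a) ^ 2 ≤ (q + 3 / 2 * a) ^ 2 := by nlinarith
  have h7 : y - a ≤ q + 3 / 2 * a := le_of_sq_le_sq h6 (by positivity)
  linarith

theorem sqrt_mul_le_half_add {a b : ℝ} (ha : 0 ≤ a) (hb : 0 ≤ b) : √(a * b) ≤ (a + b) / 2 := by
  refine (Real.sqrt_le_left (by positivity)).2 ?_
  nlinarith [sq_nonneg (a - b)]

/-- The arithmetic of one epoch: an excess risk of order `K` in epoch `k` leads to an excess risk of
order `√K` in epoch `k + 1`. Here `a` is the fast rate of epoch `k + 1`, `ℓ` the optimal risk, `D`,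
`E`, `F` are the average risk, the average observed loss and the average observed loss of the
optimal predictor in epoch `k + 1`, and `D'`, `E'`, `H` are the average risk, the average observed
loss and its surrogate in epoch `k`. -/
theorem excess_le_of_epoch {a ℓ K D E F D' E' H : ℝ} (ha : 0 < a) (hℓ : 0 ≤ ℓ) (hK : 3600 ≤ K)
    (hℓD : ℓ ≤ D) (hE' : 0 ≤ E')
    (hB : D' - ℓ ≤ K * (2 * a + √(2 * a * ℓ))) (hb : E' ≤ 2 * D' + 4 * a)
    (hH : H = E' + 6 * (√(2 * a * E') + 2 * a)) (hℓH : ℓ ≤ H)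
    (hr : E - F ≤ √(a * H) + √(a / H) * E)
    (hF : F ≤ ℓ + √(a / (ℓ + 2 ^ 2 * a)) * ℓ + 2 * a / √(a / (ℓ + 2 ^ 2 * a)))
    (hD : D ≤ E + √(a / (ℓ + 2 ^ 2 * a)) * D + 2 * a / √(a / (ℓ + 2 ^ 2 * a))) :
    D - ℓ ≤ K * (a + √(a * ℓ)) := by
  have u1 := sqrt_div_add_mul_le ha hℓ two_pos
  have u2 := div_sqrt_div_add_le ha hℓ two_pos
  have u3 := sqrt_div_add_le ha hℓ two_pos
  rw [mul_div_assoc] at hF hD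
  set u := √(a / (ℓ + 2 ^ 2 * a))
  have hy0 := Real.sqrt_nonneg (a * ℓ)
  have hy := Real.sq_sqrt (mul_nonneg ha.le hℓ)
  -- The additive term of the surrogate bounds `a / H`, so that the term `g * E` of the regret can
  -- be absorbed on the left.
  have hHlow : 12 * a ≤ H := by
    have := Real.sqrt_nonneg (2 * a * E')
    linarith
  have hHpos : 0 < H := by linarith
  have hg0 := Real.sqrt_nonneg (a / H)
  have hg : √(a / H) ≤ 1 / 2 := by
    refine (Real.sqrt_le_left (by positivity)).2 ?_
    rw [div_le_iff₀ hHpos]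
    linarith
  -- Here `ℓ ≤ H` is essential: the step size is not too large.
  have hgℓ : √(a / H) * ℓ ≤ √(a * ℓ) := by
    refine Real.le_sqrt_of_sq_le ?_
    rw [mul_pow, Real.sq_sqrt (by positivity), div_mul_eq_mul_div, div_le_iff₀ hHpos]
    have := mul_le_mul_of_nonneg_left hℓH (mul_nonneg ha.le hℓ)
    nlinarith
  have hHup : H ≤ 144 * K * (a + ℓ) := by
    have h1 : √(2 * a * E') ≤ (2 * a + E') / 2 := sqrt_mul_le_half_add (by positivity) hE'
    have h2 : √(2 * a * ℓ) ≤ (2 * a + ℓ) / 2 := sqrt_mul_le_half_add (by positivity) hℓ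
    have h3 : K * (2 * a + √(2 * a * ℓ)) ≤ K * (3 * (a + ℓ)) := by
      refine mul_le_mul_of_nonneg_left ?_ (by linarith)
      linarith
    have h4 : a + ℓ ≤ K * (a + ℓ) := le_mul_of_one_le_left (by positivity) (by linarith)
    linarith
  -- The gain from `K` to `√K`.
  have haH : √(a * H) ≤ 12 * √K * (a + √(a * ℓ)) := by
    refine (Real.sqrt_le_left (by positivity)).2 ?_
    rw [mul_pow, mul_pow, Real.sq_sqrt (by linarith)]
    calc a * H ≤ a * (144 * K * (a + ℓ)) := mul_le_mul_of_nonneg_left hHup ha.le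
      _ = 12 ^ 2 * K * (a ^ 2 + √(a * ℓ) ^ 2) := by rw [hy]; ring
      _ ≤ 12 ^ 2 * K * (a + √(a * ℓ)) ^ 2 := by
        refine mul_le_mul_of_nonneg_left ?_ (by linarith)
        nlinarith
  set y := √(a * ℓ)
  set g := √(a / H)
  have hG0 := Real.sqrt_nonneg (a * H)
  have hF' : F ≤ ℓ + 5 * (a + y) := by linarith
  have hgF : g * F ≤ 4 * (a + y) := by
    have h1 := mul_le_mul_of_nonneg_left hF' hg0
    have h2 : g * (5 * (a + y)) ≤ 1 / 2 * (5 * (a + y)) :=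
      mul_le_mul_of_nonneg_right hg (by positivity)
    linarith
  have hEF : E - F ≤ 2 * √(a * H) + 8 * (a + y) := by
    by_contra! hcon
    have : 1 / 2 * (E - F) ≤ (1 - g) * (E - F) :=
      mul_le_mul_of_nonneg_right (by linarith) (by linarith)
    linarith
  have hDℓ : D - ℓ ≤ 4 * √(a * H) + 36 * (a + y) := by
    have : 1 / 2 * (D - ℓ) ≤ (1 - u) * (D - ℓ) :=
      mul_le_mul_of_nonneg_right (by linarith) (by linarith)
    linarith
  -- The threshold `3600 = 60²` ensures `48 √K + 36 ≤ K`, closing the induction.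
  have hsK : 60 ≤ √K := Real.le_sqrt_of_sq_le (by linarith)
  have hsK2 : √K ^ 2 = K := Real.sq_sqrt (by linarith)
  calc D - ℓ ≤ (48 * √K + 36) * (a + y) := by linarith
    _ ≤ K * (a + y) := by
      refine mul_le_mul_of_nonneg_right ?_ (by positivity)
      nlinarith

/-- A lower deviation bound for an exponential moment, in additive form. -/
theorem le_add_of_neg_deviation {u D E b : ℝ} (hu : 0 < u) (hu1 : u ≤ 1) (hD : 0 ≤ D)
    (h : -u * E ≤ (Real.exp (-u) - 1) * D + b) : D ≤ E + u * D + b / u := by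
  have h1 := (abs_le.1 (Real.abs_exp_sub_one_sub_id_le (x := -u)
    (by rw [abs_neg, abs_of_pos hu]; exact hu1))).2
  have h2 : (Real.exp (-u) - 1) * D ≤ (-u + u ^ 2) * D :=
    mul_le_mul_of_nonneg_right (by linarith [neg_sq u]) hD
  have h3 : u * D ≤ u * (E + u * D + b / u) := by
    have : u * (E + u * D + b / u) = u * E + u ^ 2 * D + b := by field_simp
    linarith
  exact le_of_mul_le_mul_left h3 hu

/-- An upper deviation bound for an exponential moment, in additive form. -/
theorem le_add_of_pos_deviation {u D E b : ℝ} (hu : 0 < u) (hu1 : u ≤ 1) (hD : 0 ≤ D)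
    (h : u * E ≤ (Real.exp u - 1) * D + b) : E ≤ D + u * D + b / u := by
  have h1 := (abs_le.1 (Real.abs_exp_sub_one_sub_id_le (x := u) (by rwa [abs_of_pos hu]))).2
  have h2 : (Real.exp u - 1) * D ≤ (u + u ^ 2) * D :=
    mul_le_mul_of_nonneg_right (by linarith) hD
  have h3 : u * E ≤ u * (D + u * D + b / u) := by
    have : u * (D + u * D + b / u) = u * D + u ^ 2 * D + b := by field_simp
    linarith
  exact le_of_mul_le_mul_left h3 hu

/-! ### Risks and regret under the standing assumptions. -/

namespace DoublingData

variable (p : DoublingData) {d : ℕ}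

/-- The standing assumptions on the loss function and on the parameters. -/
structure Admissible : Prop where
  nonneg : ∀ z, 0 ≤ p.φ z
  convex : ConvexOn ℝ Set.univ p.φ
  differentiable : Differentiable ℝ p.φ
  deriv_le : ∀ z, |deriv p.φ z| ≤ p.L
  deriv_lipschitz : ∀ z z', |deriv p.φ z - deriv p.φ z'| ≤ p.γ * |z - z'|
  γ_pos : 0 < p.γ
  R_pos : 0 < p.R
  C_pos : 0 < p.C
  δ_pos : 0 < p.δ
  δ_lt : p.δ < 1
  one_le_m : 1 ≤ p.m
  one_le_T₁ : 1 ≤ p.T₁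

/-- The average loss of the fixed predictor `w` on the examples of epoch `k`. -/
noncomputable def fixedLoss (s : ℕ → Example d) (k : ℕ) (w : EuclideanSpace ℝ (Fin d)) : ℝ :=
  (1 / (p.T k : ℝ)) * ∑ i ∈ Finset.range (p.T k), sampleLoss p.φ (p.block s k i) w

variable {p}

namespace Admissible

variable (hp : p.Admissible)

section Risk

variable {μ : Measure (Example d)} [IsProbabilityMeasure μ]
  (hμ : ∀ᵐ z ∂μ, ‖z.1‖ ≤ 1 ∧ (z.2 = 1 ∨ z.2 = -1))

include hp

theorem one_le_t : 1 ≤ p.t := p.one_le_t hp.γ_pos hp.C_pos hp.δ_pos hp.δ_lt hp.one_le_m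

theorem fastRate_pos (k : ℕ) : 0 < p.C * p.t / p.T k :=
  div_pos (mul_pos hp.C_pos (by linarith [hp.one_le_t])) (p.T_pos hp.one_le_T₁ k)

theorem fastRate_succ {k : ℕ} (hk : 1 ≤ k) :
    p.C * p.t / p.T k = 2 * (p.C * p.t / p.T (k + 1)) := by
  have h := p.T_pos hp.one_le_T₁ k
  rw [p.T_succ hk]
  field_simp

theorem empLoss_nonneg (s : ℕ → Example d) (k : ℕ) : 0 ≤ p.empLoss s k :=
  mul_nonneg (by positivity) (Finset.sum_nonneg fun _ _ => hp.nonneg _)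

theorem surrogate_pos (s : ℕ → Example d) (k : ℕ) : 0 < p.surrogate s k := by
  have h1 := hp.empLoss_nonneg s k
  have h2 := hp.fastRate_pos k
  have h3 := Real.sqrt_nonneg (p.C * p.t / p.T k * p.empLoss s k)
  unfold surrogate surrogateOf
  linarith

omit [IsProbabilityMeasure μ] in
theorem expectedLoss_nonneg (w : EuclideanSpace ℝ (Fin d)) : 0 ≤ expectedLoss p.φ μ w :=
  integral_nonneg fun _ => hp.nonneg _

include hμ

omit [IsProbabilityMeasure μ] in
theorem ae_sampleLoss_mem {w : EuclideanSpace ℝ (Fin d)} (hw : ‖w‖ ≤ p.R) :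
    ∀ᵐ z ∂μ, 0 ≤ sampleLoss p.φ z w ∧ sampleLoss p.φ z w ≤ p.C := by
  filter_upwards [hμ] with z hz
  exact ⟨hp.nonneg _, sampleLoss_le hp.differentiable hp.deriv_le hz hw⟩

theorem integrable_sampleLoss {w : EuclideanSpace ℝ (Fin d)} (hw : ‖w‖ ≤ p.R) :
    Integrable (fun z => sampleLoss p.φ z w) μ := by
  refine Integrable.of_bound ((measurable_sampleLoss hp.differentiable.continuous.measurable).comp
    (measurable_id.prodMk measurable_const)).aestronglyMeasurable p.C ?_
  filter_upwards [hp.ae_sampleLoss_mem hμ hw] with z hz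
  rw [Real.norm_of_nonneg hz.1]
  exact hz.2

theorem expectedLoss_le {w : EuclideanSpace ℝ (Fin d)} (hw : ‖w‖ ≤ p.R) :
    expectedLoss p.φ μ w ≤ p.C := by
  have h := integral_mono_ae (hp.integrable_sampleLoss hμ hw) (integrable_const p.C)
    ((hp.ae_sampleLoss_mem hμ hw).mono fun z hz => hz.2)
  simpa [expectedLoss] using h

/-- Stated on the ball, where the bound by `C` supplies integrability; it serves Jensen's inequality
for the averaged iterate. -/
theorem convexOn_expectedLoss :
    ConvexOn ℝ (Metric.closedBall (0 : EuclideanSpace ℝ (Fin d)) p.R) (expectedLoss p.φ μ) := by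
  refine ⟨convex_closedBall _ _, fun u hu v hv a b ha hb hab => ?_⟩
  have huv := convex_closedBall (0 : EuclideanSpace ℝ (Fin d)) p.R hu hv ha hb hab
  rw [mem_closedBall_zero_iff] at hu hv huv
  have hi := hp.integrable_sampleLoss hμ hu
  have hj := hp.integrable_sampleLoss hμ hv
  unfold expectedLoss
  rw [smul_eq_mul, smul_eq_mul, ← integral_const_mul, ← integral_const_mul,
    ← integral_add (hi.const_mul a) (hj.const_mul b)]
  exact integral_mono (hp.integrable_sampleLoss hμ huv) ((hi.const_mul a).add (hj.const_mul b))
    fun z => (convexOn_sampleLoss hp.convex z).2 (Set.mem_univ u) (Set.mem_univ v) ha hb hab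

theorem expectedLoss_avgIterate_le (s : ℕ → Example d) (k : ℕ) :
    expectedLoss p.φ μ (p.avgIterate s k) ≤ p.avgRisk μ s k := by
  have hT := p.T_pos hp.one_le_T₁ k
  have h := (hp.convexOn_expectedLoss hμ).map_sum_le (t := Finset.range (p.T k))
    (w := fun _ => 1 / (p.T k : ℝ)) (p := fun i => p.iterate s k i) (fun _ _ => by positivity)
    (by rw [Finset.sum_const, Finset.card_range, nsmul_eq_mul]; field_simp)
    (fun i _ => mem_closedBall_zero_iff.2 (p.norm_iterate_le hp.R_pos.le s k i))
  rw [← Finset.smul_sum, ← Finset.smul_sum] at h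
  exact h

theorem avgRisk_le (s : ℕ → Example d) (k : ℕ) : p.avgRisk μ s k ≤ p.C := by
  have hT := p.T_pos hp.one_le_T₁ k
  unfold avgRisk
  rw [one_div, inv_mul_le_iff₀ hT]
  calc ∑ i ∈ Finset.range (p.T k), expectedLoss p.φ μ (p.iterate s k i)
      ≤ ∑ _i ∈ Finset.range (p.T k), p.C :=
        Finset.sum_le_sum fun i _ => hp.expectedLoss_le hμ (p.norm_iterate_le hp.R_pos.le s k i)
    _ = p.T k * p.C := by simp

omit hμ [IsProbabilityMeasure μ] in
theorem le_avgRisk {w : EuclideanSpace ℝ (Fin d)}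
    (hmin : ∀ v : EuclideanSpace ℝ (Fin d), ‖v‖ ≤ p.R →
      expectedLoss p.φ μ w ≤ expectedLoss p.φ μ v) (s : ℕ → Example d) (k : ℕ) :
    expectedLoss p.φ μ w ≤ p.avgRisk μ s k := by
  have hT := p.T_pos hp.one_le_T₁ k
  unfold avgRisk
  rw [one_div, le_inv_mul_iff₀ hT]
  calc (p.T k : ℝ) * expectedLoss p.φ μ w
      = ∑ _i ∈ Finset.range (p.T k), expectedLoss p.φ μ w := by simp
    _ ≤ _ := Finset.sum_le_sum fun i _ => hmin _ (p.norm_iterate_le hp.R_pos.le s k i)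

end Risk

include hp in
-- With `q = √(γ N H)` and `η = R / (2q)` the two regret terms are `R q / N` and `(R γ / q) E`;
-- comparing squares, `R²γ ≤ C t` bounds both.
theorem empLoss_sub_fixedLoss_le {s : ℕ → Example d}
    (hs : ∀ i, ‖(s i).1‖ ≤ 1 ∧ ((s i).2 = 1 ∨ (s i).2 = -1)) {u : EuclideanSpace ℝ (Fin d)}
    (hu : ‖u‖ ≤ p.R) {k : ℕ} (hk : 1 ≤ k) :
    p.empLoss s (k + 1) - p.fixedLoss s (k + 1) u
      ≤ √(p.C * p.t / p.T (k + 1) * p.surrogate s k)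
        + √(p.C * p.t / p.T (k + 1) / p.surrogate s k) * p.empLoss s (k + 1) := by
  have hT := p.T_pos hp.one_le_T₁ (k + 1)
  have hH := hp.surrogate_pos s k
  have hstep : p.stepSize s (k + 1)
      = p.R / (2 * √(p.γ * p.T (k + 1) * p.surrogate s k)) := by
    obtain ⟨k, rfl⟩ : ∃ l, k = l + 1 := ⟨k - 1, by omega⟩
    rfl
  have hE := hp.empLoss_nonneg s (k + 1)
  have hsm := p.smoothness_le hp.C_pos hp.δ_pos hp.δ_lt hp.one_le_m
  have hR := hp.R_pos
  have hγ := hp.γ_pos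
  set N : ℝ := (p.T (k + 1) : ℝ)
  set H := p.surrogate s k
  set η := p.stepSize s (k + 1) with hη
  set q := √(p.γ * N * H) with hq
  have hq2 : q ^ 2 = p.γ * N * H := Real.sq_sqrt (by positivity)
  have hqpos : 0 < q := Real.sqrt_pos.2 (by positivity)
  have hηpos : 0 < η := by rw [hstep]; positivity
  have hreg := sgd_regret hp.nonneg hp.convex hp.differentiable hγ hp.deriv_lipschitz hR hηpos
    (s := p.block s (k + 1)) (fun i => hs _) hu (p.T (k + 1))
  have hEA : p.empLoss s (k + 1) = 1 / N * ∑ i ∈ Finset.range (p.T (k + 1)),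
      sampleLoss p.φ (p.block s (k + 1) i) (sgd p.φ p.R η (p.block s (k + 1)) i) := rfl
  have hFB : p.fixedLoss s (k + 1) u = 1 / N * ∑ i ∈ Finset.range (p.T (k + 1)),
      sampleLoss p.φ (p.block s (k + 1) i) u := rfl
  rw [Finset.sum_sub_distrib] at hreg
  have h1 : p.empLoss s (k + 1) - p.fixedLoss s (k + 1) u
      ≤ p.R * q / N + p.R * p.γ / q * p.empLoss s (k + 1) := by
    rw [hEA, hFB, ← mul_sub]
    refine (mul_le_mul_of_nonneg_left hreg (by positivity)).trans_eq ?_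
    rw [hstep]
    field_simp
  refine h1.trans (add_le_add ?_ (mul_le_mul_of_nonneg_right ?_ hE))
  · refine Real.le_sqrt_of_sq_le ?_
    rw [div_pow, mul_pow, hq2, div_mul_eq_mul_div, div_le_div_iff₀ (by positivity) hT]
    have := mul_le_mul_of_nonneg_right hsm (by positivity : 0 ≤ H * N ^ 2)
    linarith
  · refine Real.le_sqrt_of_sq_le ?_
    rw [div_pow, mul_pow, hq2, div_div, div_le_div_iff₀ (by positivity) (by positivity)]
    have := mul_le_mul_of_nonneg_right hsm (by positivity : 0 ≤ p.γ * N * H)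
    linarith

/-! ### High-probability bounds for one epoch. -/

section Concentration

variable {μ : Measure (Example d)} [IsProbabilityMeasure μ]
  (hμ : ∀ᵐ z ∂μ, ‖z.1‖ ≤ 1 ∧ (z.2 = 1 ∨ z.2 = -1))
  {Ω : Type*} [MeasurableSpace Ω] {P : Measure Ω} [IsProbabilityMeasure P]
  {Z : ℕ → Ω → Example d} (hZ : ∀ i, Measurable (Z i)) (hlaw : ∀ i, P.map (Z i) = μ)
  (hind : iIndepFun Z P)

include hp hμ hZ hlaw hind

theorem measureReal_average_deviation_le {W : ℕ → (ℕ → Example d) → EuclideanSpace ℝ (Fin d)}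
    (hW : ∀ i, Measurable (W i)) (hWR : ∀ i s, ‖W i s‖ ≤ p.R) (k : ℕ)
    (hadapt : ∀ i s s', (∀ j < p.start k + i, s j = s' j) → W i s = W i s') (c r : ℝ) :
    P.real {ω | (Real.exp c - 1) * (1 / (p.T k : ℝ) * ∑ i ∈ Finset.range (p.T k),
          expectedLoss p.φ μ (W i fun j => Z j ω)) + p.C * r / p.T k
        < c * (1 / (p.T k : ℝ) * ∑ i ∈ Finset.range (p.T k),
          sampleLoss p.φ (p.block (fun j => Z j ω) k i) (W i fun j => Z j ω))}
      ≤ Real.exp (-r) := by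
  have hT := p.T_pos hp.one_le_T₁ k
  refine (measureReal_mono ?_).trans (measureReal_adapted_deviation_le hZ hlaw hind
    (measurable_sampleLoss hp.differentiable.continuous.measurable) hW (p.start k) hadapt
    hp.C_pos (fun i s => hp.ae_sampleLoss_mem hμ (hWR i s)) c r (p.T k))
  intro ω hω
  simp only [Set.mem_ofPred_eq] at hω ⊢
  have h := mul_lt_mul_of_pos_right hω hT
  simp only [block, expectedLoss] at h ⊢
  field_simp at h
  exact h

theorem measureReal_iterate_deviation_le {k : ℕ} (hk : 1 ≤ k) (c r : ℝ) :
    P.real {ω | (Real.exp c - 1) * p.avgRisk μ (fun j => Z j ω) k + p.C * r / p.T k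
      < c * p.empLoss (fun j => Z j ω) k} ≤ Real.exp (-r) :=
  hp.measureReal_average_deviation_le hμ hZ hlaw hind
    (W := fun i s => p.iterate s k i) (fun i => p.measurable_iterate hp.differentiable k i)
    (fun i s => p.norm_iterate_le hp.R_pos.le s k i) k
    (fun _ _ _ h => p.iterate_congr hk h) c r

theorem measureReal_fixed_deviation_le {w : EuclideanSpace ℝ (Fin d)} (hw : ‖w‖ ≤ p.R) (k : ℕ)
    (c r : ℝ) :
    P.real {ω | (Real.exp c - 1) * expectedLoss p.φ μ w + p.C * r / p.T k
      < c * p.fixedLoss (fun j => Z j ω) k w} ≤ Real.exp (-r) := by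
  have hT := p.T_pos hp.one_le_T₁ k
  have h := hp.measureReal_average_deviation_le hμ hZ hlaw hind
    (W := fun _ _ => w) (fun _ => measurable_const) (fun _ _ => hw) k
    (fun _ _ _ _ => rfl) c r
  have h1 : 1 / (p.T k : ℝ) * ∑ _i ∈ Finset.range (p.T k), expectedLoss p.φ μ w
      = expectedLoss p.φ μ w := by
    rw [Finset.sum_const, Finset.card_range, nsmul_eq_mul]; field_simp
  rw [h1] at h
  exact h

/-- The surrogate fails to be an upper bound of the optimal risk with probability at most
`exp (-t)`. -/
theorem measureReal_surrogate_lt_le {w : EuclideanSpace ℝ (Fin d)}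
    (hmin : ∀ v : EuclideanSpace ℝ (Fin d), ‖v‖ ≤ p.R →
      expectedLoss p.φ μ w ≤ expectedLoss p.φ μ v) {k : ℕ} (hk : 1 ≤ k) :
    P.real {ω | p.surrogate (fun j => Z j ω) k < expectedLoss p.φ μ w} ≤ Real.exp (-p.t) := by
  have ha := hp.fastRate_pos k
  have hℓ := hp.expectedLoss_nonneg (μ := μ) w
  set a := p.C * p.t / p.T k with ha_def
  set ℓ := expectedLoss p.φ μ w
  have hu : 0 < √(a / (ℓ + 1 ^ 2 * a)) := Real.sqrt_pos.2 (by positivity)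
  have hu1 := sqrt_div_add_le ha hℓ one_pos
  rw [div_one] at hu1
  refine (measureReal_mono ?_).trans (hp.measureReal_iterate_deviation_le hμ hZ hlaw hind hk
    (-√(a / (ℓ + 1 ^ 2 * a))) p.t)
  intro ω hω
  simp only [Set.mem_ofPred_eq] at hω ⊢
  by_contra! hcon
  have hD := hp.le_avgRisk hmin (fun j => Z j ω) k
  have h := le_add_of_neg_deviation hu hu1 (hℓ.trans hD) hcon
  exact hω.not_ge (le_add_sqrt_of_lower_deviation ha hℓ hD (hp.empLoss_nonneg _ k) h)

/-- Off four deviation events and a null set, `excess_le_of_epoch` applies. The surrogate event is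
tied to level `t` by the algorithm; the other three are taken at level `2t`, which makes their total
cost affordable. -/
theorem measureReal_epoch_failure_le {K : ℝ} (hK : 3600 ≤ K) {w : EuclideanSpace ℝ (Fin d)}
    (hw : ‖w‖ ≤ p.R) (hmin : ∀ v : EuclideanSpace ℝ (Fin d), ‖v‖ ≤ p.R →
      expectedLoss p.φ μ w ≤ expectedLoss p.φ μ v) {k : ℕ} (hk : 1 ≤ k) :
    P.real {ω | p.avgRisk μ (fun i => Z i ω) k - expectedLoss p.φ μ w
          ≤ K * p.rate (p.T k) (expectedLoss p.φ μ w) ∧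
        ¬ (p.avgRisk μ (fun i => Z i ω) (k + 1) - expectedLoss p.φ μ w
          ≤ K * p.rate (p.T (k + 1)) (expectedLoss p.φ μ w))}
      ≤ Real.exp (-p.t) + 3 * Real.exp (-(2 * p.t)) := by
  have ha := hp.fastRate_pos (k + 1)
  have ha2 := hp.fastRate_succ hk
  have hT := p.T_pos hp.one_le_T₁ (k + 1)
  have hTk := p.T_pos hp.one_le_T₁ k
  have hℓ := hp.expectedLoss_nonneg (μ := μ) w
  have hb : ∀ j, p.C * (2 * p.t) / p.T j = 2 * (p.C * p.t / p.T j) := fun j => by ring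
  have e1 := hp.measureReal_surrogate_lt_le hμ hZ hlaw hind hmin hk
  -- The crude parameter `1` suffices: the surrogate is needed from above only up to a constant
  -- factor.
  have e2 := hp.measureReal_iterate_deviation_le hμ hZ hlaw hind hk 1 (2 * p.t)
  have hu1 := sqrt_div_add_le ha hℓ two_pos
  have hu : 0 < √(p.C * p.t / p.T (k + 1) / (expectedLoss p.φ μ w
      + 2 ^ 2 * (p.C * p.t / p.T (k + 1)))) := Real.sqrt_pos.2 (by positivity)
  set u := √(p.C * p.t / p.T (k + 1) / (expectedLoss p.φ μ w
      + 2 ^ 2 * (p.C * p.t / p.T (k + 1)))) with hu_def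
  have e3 := hp.measureReal_iterate_deviation_le hμ hZ hlaw hind (Nat.le_add_left 1 k) (-u)
    (2 * p.t)
  have e4 := hp.measureReal_fixed_deviation_le hμ hZ hlaw hind hw (k + 1) u (2 * p.t)
  have hvalid : ∀ᵐ ω ∂P, ∀ i, ‖(Z i ω).1‖ ≤ 1 ∧ ((Z i ω).2 = 1 ∨ (Z i ω).2 = -1) := by
    rw [ae_all_iff]
    intro i
    rw [← hlaw i] at hμ
    exact ae_of_ae_map (hZ i).aemeasurable hμ
  have e5 : P.real {ω | ¬ ∀ i, ‖(Z i ω).1‖ ≤ 1 ∧ ((Z i ω).2 = 1 ∨ (Z i ω).2 = -1)} = 0 := by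
    rw [measureReal_eq_zero_iff]
    exact hvalid
  set A1 := {ω | p.surrogate (fun j => Z j ω) k < expectedLoss p.φ μ w} with hA1
  set A2 := {ω | (Real.exp 1 - 1) * p.avgRisk μ (fun j => Z j ω) k + p.C * (2 * p.t) / p.T k
      < 1 * p.empLoss (fun j => Z j ω) k} with hA2
  set A3 := {ω | (Real.exp (-u) - 1) * p.avgRisk μ (fun j => Z j ω) (k + 1)
      + p.C * (2 * p.t) / p.T (k + 1) < -u * p.empLoss (fun j => Z j ω) (k + 1)} with hA3
  set A4 := {ω | (Real.exp u - 1) * expectedLoss p.φ μ w + p.C * (2 * p.t) / p.T (k + 1)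
      < u * p.fixedLoss (fun j => Z j ω) (k + 1) w} with hA4
  set A5 := {ω | ¬ ∀ i, ‖(Z i ω).1‖ ≤ 1 ∧ ((Z i ω).2 = 1 ∨ (Z i ω).2 = -1)} with hA5
  have hsub : {ω | p.avgRisk μ (fun i => Z i ω) k - expectedLoss p.φ μ w
          ≤ K * p.rate (p.T k) (expectedLoss p.φ μ w) ∧
        ¬ (p.avgRisk μ (fun i => Z i ω) (k + 1) - expectedLoss p.φ μ w
          ≤ K * p.rate (p.T (k + 1)) (expectedLoss p.φ μ w))}
      ⊆ A1 ∪ (A2 ∪ (A3 ∪ (A4 ∪ A5))) := by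
    rintro ω ⟨hB, hB'⟩
    by_contra hcon
    simp only [Set.mem_union, not_or, hA1, hA2, hA3, hA4, hA5, Set.mem_ofPred_eq, not_lt,
      not_not, one_mul] at hcon
    obtain ⟨h1, h2, h3, h4, h5⟩ := hcon
    refine hB' ?_
    unfold rate at hB ⊢
    rw [ha2] at hB
    rw [hb, ha2] at h2
    rw [hb] at h3 h4
    have hDk := hℓ.trans (hp.le_avgRisk hmin (fun i => Z i ω) k)
    have hD := hp.le_avgRisk hmin (fun i => Z i ω) (k + 1)
    have he : (Real.exp 1 - 1) * p.avgRisk μ (fun i => Z i ω) k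
        ≤ 2 * p.avgRisk μ (fun i => Z i ω) k :=
      mul_le_mul_of_nonneg_right (by linarith [Real.exp_one_lt_d9]) hDk
    refine excess_le_of_epoch (E := p.empLoss (fun i => Z i ω) (k + 1))
      (F := p.fixedLoss (fun i => Z i ω) (k + 1) w) (E' := p.empLoss (fun i => Z i ω) k)
      (H := p.surrogate (fun i => Z i ω) k) ha hℓ hK hD (hp.empLoss_nonneg _ k) hB
      (by linarith) ?_ h1 (hp.empLoss_sub_fixedLoss_le h5 hw hk) ?_ ?_
    · unfold surrogate surrogateOf
      rw [ha2]
    · exact le_add_of_pos_deviation hu (by linarith) hℓ h4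
    · exact le_add_of_neg_deviation hu (by linarith) (hℓ.trans hD) h3
  have f0 := measureReal_mono (μ := P) hsub
  have f1 := measureReal_union_le (μ := P) A1 (A2 ∪ (A3 ∪ (A4 ∪ A5)))
  have f2 := measureReal_union_le (μ := P) A2 (A3 ∪ (A4 ∪ A5))
  have f3 := measureReal_union_le (μ := P) A3 (A4 ∪ A5)
  have f4 := measureReal_union_le (μ := P) A4 A5
  linarith

end Concentration

include hp in
theorem exp_neg_t_le : Real.exp (-p.t) ≤ p.δ / p.m :=
  (p.exp_neg_t_le hp.γ_pos hp.C_pos hp.δ_pos hp.one_le_m).trans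
    (mul_le_of_le_one_right (div_nonneg hp.δ_pos.le (Nat.cast_nonneg _))
      (Real.exp_le_one_iff.2 (by norm_num)))

include hp in
-- As `exp (-1) ≤ 2/5`, the sum is at most `(2/5)(1 + 6/5) = 22/25` times `δ / m`.
theorem exp_neg_t_add_le : Real.exp (-p.t) + 3 * Real.exp (-(2 * p.t)) ≤ p.δ / p.m := by
  have h1 := p.exp_neg_t_le hp.γ_pos hp.C_pos hp.δ_pos hp.one_le_m
  have h2 : Real.exp (-(2 * p.t)) ≤ Real.exp (-p.t) * Real.exp (-1) := by
    rw [← Real.exp_add]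
    exact Real.exp_le_exp.2 (by linarith [hp.one_le_t])
  have h3 : Real.exp (-1) ≤ 2 / 5 := by
    rw [Real.exp_neg, inv_le_comm₀ (Real.exp_pos 1) (by norm_num)]
    linarith [Real.exp_one_gt_d9]
  have h4 : 0 ≤ p.δ / p.m := div_nonneg hp.δ_pos.le (Nat.cast_nonneg _)
  have h5 := mul_le_mul_of_nonneg_left h3 h4
  have h6 := mul_le_mul_of_nonneg_left h3 (Real.exp_pos (-p.t)).le
  linarith

end Admissible
end DoublingData

/-! ### Chaining the epochs and the main theorem. -/

namespace DoublingData.Admissible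

variable {p : DoublingData} (hp : p.Admissible) {d : ℕ}

include hp

theorem rate_nonneg (N : ℕ) {r : ℝ} : 0 ≤ p.rate N r := by
  have h := hp.one_le_t
  have h1 := hp.C_pos
  have h2 : 0 ≤ p.C * p.t / N := by positivity
  exact add_nonneg h2 (Real.sqrt_nonneg _)

/-- By doubling, the last epoch contains at least half of all examples; this is the factor `2` of
the final rate. -/
theorem rate_T_le {r : ℝ} (hr : 0 ≤ r) : p.rate (p.T p.m) r ≤ 2 * p.rate p.n r := by
  have hT := p.T_pos hp.one_le_T₁ p.m
  have hn : (0 : ℝ) < p.n := hT.trans_le (p.T_le_n hp.one_le_m)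
  have hCt : 0 < p.C * p.t := mul_pos hp.C_pos (by linarith [hp.one_le_t])
  have h1 : p.C * p.t / p.T p.m ≤ 2 * (p.C * p.t / p.n) := by
    rw [← mul_div_assoc, div_le_div_iff₀ hT hn]
    have := mul_le_mul_of_nonneg_left (p.n_le hp.one_le_m) hCt.le
    linarith
  have h2 : √(p.C * p.t / p.T p.m * r) ≤ 2 * √(p.C * p.t / p.n * r) := by
    have hx : 0 ≤ p.C * p.t / p.n * r := by positivity
    refine (Real.sqrt_le_left (by positivity)).2 ?_
    rw [mul_pow, Real.sq_sqrt hx]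
    have := mul_le_mul_of_nonneg_right h1 hr
    linarith
  unfold rate
  linarith

/-- Chaining the epochs: a bound for the first epoch and small failure probabilities of the
induction steps yield the final optimistic rate. -/
theorem measureReal_all_epochs_ge {μ : Measure (Example d)} [IsProbabilityMeasure μ]
    (hμ : ∀ᵐ z ∂μ, ‖z.1‖ ≤ 1 ∧ (z.2 = 1 ∨ z.2 = -1))
    {Ω : Type*} [MeasurableSpace Ω] {P : Measure Ω} [IsProbabilityMeasure P]
    (Z : ℕ → Ω → Example d) {K : ℝ} (hK : 0 ≤ K) (w : EuclideanSpace ℝ (Fin d))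
    (hstep : ∀ k, 1 ≤ k → k + 1 ≤ p.m →
      P.real {ω |
        p.avgRisk μ (fun i => Z i ω) k - expectedLoss p.φ μ w
          ≤ K * p.rate (p.T k) (expectedLoss p.φ μ w) ∧
        ¬ (p.avgRisk μ (fun i => Z i ω) (k + 1) - expectedLoss p.φ μ w
          ≤ K * p.rate (p.T (k + 1)) (expectedLoss p.φ μ w))} ≤ p.δ / p.m) {q : ℝ}
    (hq : 1 - q ≤ P.real {ω | p.avgRisk μ (fun i => Z i ω) 1 - expectedLoss p.φ μ w
          ≤ K * p.rate (p.T 1) (expectedLoss p.φ μ w)}) :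
    1 - q - p.δ ≤ P.real {ω |
        (∀ k, 1 ≤ k → k ≤ p.m →
          p.avgRisk μ (fun i => Z i ω) k - expectedLoss p.φ μ w
            ≤ K * p.rate (p.T k) (expectedLoss p.φ μ w)) ∧
        expectedLoss p.φ μ (p.avgIterate (fun i => Z i ω) p.m) - expectedLoss p.φ μ w
          ≤ 2 * K * p.rate p.n (expectedLoss p.φ μ w)} := by
  set ℓ := expectedLoss p.φ μ w
  set B : ℕ → Set Ω := fun k =>
    {ω | p.avgRisk μ (fun i => Z i ω) k - ℓ ≤ K * p.rate (p.T k) ℓ} with hB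
  set F : ℕ → Set Ω := fun k => {ω | ω ∈ B k ∧ ω ∉ B (k + 1)} with hF
  set A := {ω | (∀ k, 1 ≤ k → k ≤ p.m →
      p.avgRisk μ (fun i => Z i ω) k - ℓ ≤ K * p.rate (p.T k) ℓ) ∧
      expectedLoss p.φ μ (p.avgIterate (fun i => Z i ω) p.m) - ℓ ≤ 2 * K * p.rate p.n ℓ} with hA
  -- If the first bound holds and a later one fails, some consecutive pair passes from success to
  -- failure.
  have hsub : B 1 ⊆ A ∪ ⋃ k ∈ Finset.Ico 1 p.m, F k := by
    intro ω hω
    by_cases hex : ω ∈ ⋃ k ∈ Finset.Ico 1 p.m, F k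
    · exact Or.inr hex
    refine Or.inl ?_
    have hall : ∀ k, 1 ≤ k → k ≤ p.m → ω ∈ B k := by
      intro k hk
      induction k, hk using Nat.le_induction with
      | base => exact fun _ => hω
      | succ k hk ih =>
        intro hkm
        by_contra hcon
        exact hex (Set.mem_biUnion (Finset.mem_coe.2 (Finset.mem_Ico.2 ⟨hk, by omega⟩))
          ⟨ih (by omega), hcon⟩)
    refine ⟨hall, ?_⟩
    have h1 : p.avgRisk μ (fun i => Z i ω) p.m - ℓ ≤ K * p.rate (p.T p.m) ℓ :=
      hall p.m hp.one_le_m le_rfl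
    have h2 := hp.expectedLoss_avgIterate_le hμ (fun i => Z i ω) p.m
    have h3 := mul_le_mul_of_nonneg_left (hp.rate_T_le (hp.expectedLoss_nonneg (μ := μ) w)) hK
    linarith
  have hsum : ∑ k ∈ Finset.Ico 1 p.m, P.real (F k) ≤ p.δ := by
    have hm : (0 : ℝ) < p.m := by exact_mod_cast hp.one_le_m
    calc ∑ k ∈ Finset.Ico 1 p.m, P.real (F k)
        ≤ ∑ _k ∈ Finset.Ico 1 p.m, p.δ / p.m := Finset.sum_le_sum fun k hk =>
          hstep k (Finset.mem_Ico.1 hk).1 (Finset.mem_Ico.1 hk).2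
      _ = (p.m - 1) * (p.δ / p.m) := by
          rw [Finset.sum_const, Nat.card_Ico, nsmul_eq_mul, Nat.cast_sub hp.one_le_m,
            Nat.cast_one]
      _ ≤ p.m * (p.δ / p.m) :=
          mul_le_mul_of_nonneg_right (by linarith) (div_nonneg hp.δ_pos.le hm.le)
      _ = p.δ := mul_div_cancel₀ _ hm.ne'
  have h1 := measureReal_mono (μ := P) hsub
  have h2 := measureReal_union_le (μ := P) A (⋃ k ∈ Finset.Ico 1 p.m, F k)
  have h3 := measureReal_biUnion_finset_le (μ := P) (Finset.Ico 1 p.m) F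
  linarith

/-- Every risk on the ball is at most `C`, and a short first epoch has fast rate at least `C`. -/
theorem avgRisk_sub_le_of_T₁_le {μ : Measure (Example d)} [IsProbabilityMeasure μ]
    (hμ : ∀ᵐ z ∂μ, ‖z.1‖ ≤ 1 ∧ (z.2 = 1 ∨ z.2 = -1)) {K : ℝ} (hK : 1 ≤ K)
    (hT : (p.T₁ : ℝ) ≤ p.t) (w : EuclideanSpace ℝ (Fin d)) (s : ℕ → Example d) :
    p.avgRisk μ s 1 - expectedLoss p.φ μ w ≤ K * p.rate (p.T 1) (expectedLoss p.φ μ w) := by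
  have h1 := hp.avgRisk_le hμ s 1
  have h2 := hp.expectedLoss_nonneg (μ := μ) w
  have h3 : p.C ≤ p.C * p.t / p.T 1 := by
    rw [le_div_iff₀ (p.T_pos hp.one_le_T₁ 1)]
    refine mul_le_mul_of_nonneg_left ?_ hp.C_pos.le
    simpa [T] using hT
  have h4 : p.C * p.t / p.T 1 ≤ p.rate (p.T 1) (expectedLoss p.φ μ w) :=
    le_add_of_nonneg_right (Real.sqrt_nonneg _)
  have h5 := le_mul_of_one_le_left (hp.rate_nonneg (p.T 1) (r := expectedLoss p.φ μ w)) hK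
  linarith

end DoublingData.Admissible

theorem mainTheorem2 :
    ∃ K₀ : ℝ, 0 < K₀ ∧ ∀ K : ℝ, K₀ ≤ K →
    ∀ (p : DoublingData)
      -- a nonnegative convex smooth loss
      (_ : ∀ z, 0 ≤ p.φ z) (_ : ConvexOn ℝ Set.univ p.φ) (_ : Differentiable ℝ p.φ)
      (_ : ∀ z, |deriv p.φ z| ≤ p.L)
      (_ : ∀ z z', |deriv p.φ z - deriv p.φ z'| ≤ p.γ * |z - z'|)
      -- the parameters
      (_ : 0 < p.γ) (_ : 0 < p.R) (_ : 0 < p.C) (_ : 0 < p.δ) (_ : p.δ < 1)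
      (_ : 1 ≤ p.m) (_ : 1 ≤ p.T₁) (_ : 0 < p.η₁)
      -- the law of the examples
      (d : ℕ) (μ : Measure (Example d)) (_ : IsProbabilityMeasure μ)
      (_ : ∀ᵐ z ∂μ, ‖z.1‖ ≤ 1 ∧ (z.2 = 1 ∨ z.2 = -1))
      -- a minimizer of the expected loss over the ball
      (wstar : EuclideanSpace ℝ (Fin d)) (_ : ‖wstar‖ ≤ p.R)
      (_ : ∀ w : EuclideanSpace ℝ (Fin d), ‖w‖ ≤ p.R →
        expectedLoss p.φ μ wstar ≤ expectedLoss p.φ μ w)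
      -- the i.i.d. examples
      (Ω : Type*) (_ : MeasurableSpace Ω) (P : Measure Ω) (_ : IsProbabilityMeasure P)
      (Z : ℕ → Ω → Example d) (_ : ∀ i, Measurable (Z i)) (_ : ∀ i, P.map (Z i) = μ)
      (_ : iIndepFun Z P),
    -- the surrogate is an upper bound of the optimal risk
    (∀ k, 1 ≤ k → k ≤ p.m →
      1 - p.δ / p.m ≤ P.real {ω | expectedLoss p.φ μ wstar ≤ p.surrogate (fun i => Z i ω) k}) ∧
    -- the induction step: the bound for epoch `k` gives the bound for epoch `k + 1`
    (∀ k, 1 ≤ k → k + 1 ≤ p.m →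
      P.real {ω |
        p.avgRisk μ (fun i => Z i ω) k - expectedLoss p.φ μ wstar
          ≤ K * p.rate (p.T k) (expectedLoss p.φ μ wstar) ∧
        ¬ (p.avgRisk μ (fun i => Z i ω) (k + 1) - expectedLoss p.φ μ wstar
          ≤ K * p.rate (p.T (k + 1)) (expectedLoss p.φ μ wstar))} ≤ p.δ / p.m) ∧
    -- the resulting rate, from a bound for the first epoch
    (∀ q : ℝ,
      1 - q ≤ P.real {ω | p.avgRisk μ (fun i => Z i ω) 1 - expectedLoss p.φ μ wstar
          ≤ K * p.rate (p.T 1) (expectedLoss p.φ μ wstar)} →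
      1 - q - p.δ ≤ P.real {ω |
        (∀ k, 1 ≤ k → k ≤ p.m →
          p.avgRisk μ (fun i => Z i ω) k - expectedLoss p.φ μ wstar
            ≤ K * p.rate (p.T k) (expectedLoss p.φ μ wstar)) ∧
        expectedLoss p.φ μ (p.avgIterate (fun i => Z i ω) p.m) - expectedLoss p.φ μ wstar
          ≤ 2 * K * p.rate p.n (expectedLoss p.φ μ wstar)}) ∧
    -- the resulting rate, without any condition when the first epoch is short
    ((p.T₁ : ℝ) ≤ p.t →
      1 - p.δ ≤ P.real {ω |
        (∀ k, 1 ≤ k → k ≤ p.m →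
          p.avgRisk μ (fun i => Z i ω) k - expectedLoss p.φ μ wstar
            ≤ K * p.rate (p.T k) (expectedLoss p.φ μ wstar)) ∧
        expectedLoss p.φ μ (p.avgIterate (fun i => Z i ω) p.m) - expectedLoss p.φ μ wstar
          ≤ 2 * K * p.rate p.n (expectedLoss p.φ μ wstar)}) := by
  refine ⟨3600, by norm_num, ?_⟩
  intro K hK p h1 h2 h3 h4 h5 h6 h7 h8 h9 h10 h11 h12 _ d μ _ hμ wstar hw hmin Ω _ P _ Z hZ hlaw
    hind
  have hp : p.Admissible := ⟨h1, h2, h3, h4, h5, h6, h7, h8, h9, h10, h11, h12⟩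
  have hstep := fun k (hk : 1 ≤ k) (_ : k + 1 ≤ p.m) =>
    (hp.measureReal_epoch_failure_le hμ hZ hlaw hind hK hw hmin hk).trans hp.exp_neg_t_add_le
  have hchain := fun q => hp.measureReal_all_epochs_ge hμ Z (by linarith) wstar hstep (q := q)
  refine ⟨fun k hk _ => ?_, hstep, hchain, fun hT => ?_⟩
  · have hbad := (hp.measureReal_surrogate_lt_le hμ hZ hlaw hind hmin hk).trans hp.exp_neg_t_le
    have huniv : (Set.univ : Set Ω)
        ⊆ {ω | expectedLoss p.φ μ wstar ≤ p.surrogate (fun i => Z i ω) k}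
          ∪ {ω | p.surrogate (fun i => Z i ω) k < expectedLoss p.φ μ wstar} :=
      fun ω _ => (le_or_gt (expectedLoss p.φ μ wstar)
        (p.surrogate (fun i => Z i ω) k)).imp (fun h => h) fun h => h
    have hmono := (measureReal_mono (μ := P) huniv).trans (measureReal_union_le _ _)
    rw [probReal_univ] at hmono
    linarith
  · have hfirst : {ω | p.avgRisk μ (fun i => Z i ω) 1 - expectedLoss p.φ μ wstar
        ≤ K * p.rate (p.T 1) (expectedLoss p.φ μ wstar)} = Set.univ :=
      Set.eq_univ_of_forall fun ω =>
        hp.avgRisk_sub_le_of_T₁_le hμ (by linarith) hT wstar fun i => Z i ω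
    have h := hchain 0 (by rw [hfirst, probReal_univ]; linarith)
    rwa [sub_zero] at h
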